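/- Let $\mathfrak g$ be a finite-dimensional complex simple Lie algebra with Killing form $\langle\cdot,\cdot\rangle$. Let $\mathfrak g\circledcirc\mathfrak g\subset\mathfrak g\otimes\mathfrak g$ be the Cartan product, i.e. the unique irreducible component of $\mathfrak g\otimes\mathfrak g$ whose highest weight is twice the highest weight of the adjoint representation $\mathfrak g$, and let $X\otimes Y\mapsto X\circledcirc Y$ be the $\mathfrak g$-invariant projection of $\mathfrak g\otimes\mathfrak g$ onto it. For $\lambda\in\mathbb C$ let $I_\lambda$ be the two-sided ideal of the tensor algebra $\bigotimes\mathfrak g$ generated by the elements $$X\otimes Y-X\circledcirc Y-\tfrac12[X,Y]-\lambda\langle X,Y\rangle,\qquad X,Y\in\mathfrak g,$$ let $A_\lambda=\bigotimes\mathfrak g/I_\lambda$, and let $\bar I_\lambda$ be the image of $I_\lambda$ in the universal enveloping algebra $\mathfrak U(\mathfrak g)$. Let $\mathfrak U_+(\mathfrak g)\subset\mathfrak U(\mathfrak g)$ be the augmentation ideal, consisting of the elements without constant part (the kernel of the algebra homomorphism $\mathfrak U(\mathfrak g)\to\mathbb C$ that vanishes on $\mathfrak g$). **Theorem.** Suppose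 that one of the following holds: - $\mathfrak g=\mathfrak{so}(n,\mathbb C)$, $n\ge 5$, and $\lambda\ne-\dfrac{n-4}{4(n-1)(n-2)}$; - $\mathfrak g=\mathfrak{sp}(2n,\mathbb C)$, $n\ge 2$, and $\lambda\ne-\dfrac{1}{16(n+1)}$; - $\mathfrak g=\mathfrak{sl}(n,\mathbb C)$, $n\ge 3$, and $\lambda\ne-\dfrac{1}{8(n+1)}$. If $\lambda\ne0$, then $\bar I_\lambda=\mathfrak U(\mathfrak g)$. If $\lambda=0$, then $\bar I_0=\mathfrak U_+(\mathfrak g)$, and this is a maximal two-sided ideal of $\mathfrak U(\mathfrak g)$. In both cases $A_\lambda$ is finite-dimensional over $\mathbb C$, of dimension at most $1$. -/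

import Mathlib

open scoped TensorProduct

namespace JosephIdeal

noncomputable section

/-- A set of functions on a Cartan subalgebra `H` is a system of positive roots if it consists of
the roots on which a linear functional on root space (given by the real part of evaluation at some
`h₀ ∈ H`), vanishing on no root, is positive. -/
def IsPositiveSystem {L : Type*} [LieRing L] [LieAlgebra ℂ L] (H : LieSubalgebra ℂ L)
    [LieRing.IsNilpotent H] (Φp : Set (H → ℂ)) : Prop :=
  ∃ h₀ : H, (∀ α : LieModule.Weight ℂ H L, α.IsNonZero → (α h₀).re ≠ 0) ∧
    Φp = {f : H → ℂ | ∃ α : LieModule.Weight ℂ H L, α.IsNonZero ∧ 0 < (α h₀).re ∧ f = (α : H → ℂ)}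

/-- `χ` is the highest weight of `V` (relative to the Cartan subalgebra `H` and the set `Φp` of
positive roots): it is a weight, and every weight of `V` is obtained from it by subtracting a sum of
positive roots. -/
def IsHighestWeight {L : Type*} [LieRing L] [LieAlgebra ℂ L] (H : LieSubalgebra ℂ L)
    [LieRing.IsNilpotent H] (Φp : Set (H → ℂ)) (V : Type*) [AddCommGroup V] [Module ℂ V]
    [LieRingModule L V] [LieModule ℂ L V] (χ : H → ℂ) : Prop :=
  (∃ μ : LieModule.Weight ℂ H V, χ = (μ : H → ℂ)) ∧
    ∀ μ : LieModule.Weight ℂ H V, χ - (μ : H → ℂ) ∈ AddSubmonoid.closure Φp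

variable (L : Type*) [LieRing L] [LieAlgebra ℂ L]

/-- `W ⊆ L ⊗ L` is the Cartan product `L ⊚ L`: an irreducible component of `L ⊗ L` whose highest
weight is twice the highest weight of the adjoint representation `L`. -/
def IsCartanSquare (W : LieSubmodule ℂ L (L ⊗[ℂ] L)) : Prop :=
  LieModule.IsIrreducible ℂ L W ∧
    ∃ (H : LieSubalgebra ℂ L) (_ : H.IsCartanSubalgebra) (Φp : Set (H → ℂ)) (θ : H → ℂ),
      IsPositiveSystem H Φp ∧ IsHighestWeight H Φp L θ ∧ IsHighestWeight H Φp W (2 • θ)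

/-- `P` is the invariant projection of `L ⊗ L` onto the Cartan product `L ⊚ L`. -/
def IsCartanProjection (P : L ⊗[ℂ] L →ₗ⁅ℂ,L⁆ L ⊗[ℂ] L) : Prop :=
  (∀ t, P (P t) = P t) ∧ IsCartanSquare L P.range

open Classical in
/-- The invariant projection of `L ⊗ L` onto the Cartan product `L ⊚ L`. It exists and is unique for
every finite-dimensional complex simple `L`; the value `0` where there is none is a default. -/
def cartanProjection : L ⊗[ℂ] L →ₗ⁅ℂ,L⁆ L ⊗[ℂ] L :=
  if h : ∃ P, IsCartanProjection L P then h.choose else 0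

/-- The inclusion of `L ⊗ L` in the tensor algebra of `L`, as its second graded piece. -/
def tensorSquareIncl : L ⊗[ℂ] L →ₗ[ℂ] TensorAlgebra ℂ L :=
  TensorProduct.lift
    ((LinearMap.mul ℂ (TensorAlgebra ℂ L)).compl₁₂ (TensorAlgebra.ι ℂ) (TensorAlgebra.ι ℂ))

/-- The element `X ⊗ Y - X ⊚ Y - ½ [X, Y] - c ⟨X, Y⟩` of the tensor algebra. -/
def josephGenerator (c : ℂ) (X Y : L) : TensorAlgebra ℂ L :=
  tensorSquareIncl L (X ⊗ₜ[ℂ] Y) - tensorSquareIncl L (cartanProjection L (X ⊗ₜ[ℂ] Y))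
    - (1 / 2 : ℂ) • TensorAlgebra.ι ℂ ⁅X, Y⁆
    - algebraMap ℂ (TensorAlgebra ℂ L) (c * killingForm ℂ L X Y)

/-- The two-sided ideal `I_c` of the tensor algebra. -/
def tensorIdeal (c : ℂ) : TwoSidedIdeal (TensorAlgebra ℂ L) :=
  TwoSidedIdeal.span {t | ∃ X Y : L, t = josephGenerator L c X Y}

/-- The algebra `A_c`, the quotient of the tensor algebra by `I_c`. -/
abbrev quotientAlgebra (c : ℂ) : Type _ := (tensorIdeal L c).ringCon.Quotient

/-- The image of `I_c` in the universal enveloping algebra (under the canonical surjection). -/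
def envelopingIdeal (c : ℂ) : TwoSidedIdeal (UniversalEnvelopingAlgebra ℂ L) :=
  (tensorIdeal L c).map (UniversalEnvelopingAlgebra.mkAlgHom ℂ L)

section

attribute [local instance] LieRing.ofAssociativeRing

/-- The augmentation ideal: the elements without constant part, that is, the kernel of the algebra
homomorphism to `ℂ` that vanishes on `L`. -/
def augmentationIdeal : TwoSidedIdeal (UniversalEnvelopingAlgebra ℂ L) :=
  TwoSidedIdeal.ker (UniversalEnvelopingAlgebra.lift ℂ (0 : L →ₗ⁅ℂ⁆ ℂ))

end

end

end JosephIdeal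

/-! Let φ be the map from L to the quotient algebra, P the Cartan projection, and C = ∑ bᵢbᵢ the
Casimir operator of a Killing-orthonormal basis, so that C = 1 on the adjoint representation. The
Cartan square contains e ⊗ e for a highest root vector e. The relation [e, [e, x]] = -s⟨e, x⟩e makes
C act there as the scalar 2 + 2s (`IsCartanProjection.exists_isExtremal`), and nothing else about P
is needed.

The relations express the product of any tensor in ker P through its bracket and its Killing
pairing. Three kinds of tensor lie in ker P: ∑ bᵢ ⊗ bᵢ and ∑ [z, bᵢ] ⊗ bᵢ, because C has the
eigenvalues 0 and 1 on them, and (C - 2 - 2s)(x ⊗ y). Take the third relation with y = bₖ, multiply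
by φ(bₖ) on the right and sum over k. The first two relations collapse all cubic terms to multiples
of φ(x), which leaves (c(s dim L - 1 - s) - (2s - 1)/8) φ(x) = 0 (`smul_map_eq_zero`). Away from one
value of c this gives φ = 0, and the quotient is spanned by 1. The constants c⟨x, y⟩ then lie in the
ideal too, so it is everything when c ≠ 0 (`isTrivialQuotient_of_ι_mem`).

The number s is found by matrix algebra, without choosing a Cartan subalgebra. Contracting the
extremality relation with matrix units forces s = 1/n for sl(n), 1/(n - 2) for so(n) and 1/(n + 1)
for sp(2n), whichever extremal element is taken. -/

namespace JosephIdeal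

open Module

/-! ### The Casimir operator of the Killing form. -/

section Casimir

variable {L : Type*} [LieRing L] [LieAlgebra ℂ L]

/-- Over `ℂ` the Killing form of a Killing Lie algebra has an orthonormal basis. -/
theorem exists_orthonormal_basis_killingForm (L : Type*) [LieRing L] [LieAlgebra ℂ L]
    [Module.Finite ℂ L] [LieAlgebra.IsKilling ℂ L] :
    ∃ b : Basis (Fin (finrank ℂ L)) ℂ L,
      ∀ i j, killingForm ℂ L (b i) (b j) = if i = j then 1 else 0 := by
  have : Invertible (2 : ℂ) := invertibleOfNonzero two_ne_zero
  obtain ⟨v, hv⟩ := LinearMap.BilinForm.exists_orthogonal_basis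
    (LieModule.traceForm_isSymm ℂ L L)
  have hne : ∀ i, killingForm ℂ L (v i) (v i) ≠ 0 := fun i =>
    hv.not_isOrtho_basis_self_of_separatingLeft
      (LieAlgebra.IsKilling.killingForm_nondegenerate ℂ L).1 i
  choose r hr using fun i => IsAlgClosed.exists_eq_mul_self (killingForm ℂ L (v i) (v i))
  have hr0 : ∀ i, r i ≠ 0 := fun i h => hne i (by rw [hr i, h, zero_mul])
  refine ⟨v.isUnitSMul (w := fun i => (r i)⁻¹) fun i => (inv_ne_zero (hr0 i)).isUnit, ?_⟩
  intro i j
  rw [Basis.isUnitSMul_apply, Basis.isUnitSMul_apply]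
  split_ifs with h
  · subst h
    have := hr0 i
    simp only [map_smul, LinearMap.smul_apply, smul_eq_mul]
    rw [hr i]
    field_simp
  · have : killingForm ℂ L (v i) (v j) = 0 := hv h
    simp [this]

variable {ι : Type*} [Fintype ι] [DecidableEq ι] (b : Basis ι ℂ L)
  (hb : ∀ i j, killingForm ℂ L (b i) (b j) = if i = j then 1 else 0)

include hb in
theorem repr_eq_killingForm (x : L) (i : ι) : b.repr x i = killingForm ℂ L x (b i) := by
  conv_rhs => rw [← b.sum_repr x]
  simp [-Basis.sum_repr, hb]

include hb in
theorem sum_killingForm_smul (x : L) : ∑ i, killingForm ℂ L x (b i) • b i = x := by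
  conv_rhs => rw [← b.sum_repr x]
  simp only [repr_eq_killingForm b hb]

include hb in
/-- Invariance of the Casimir tensor `∑ bᵢ ⊗ bᵢ`, tested on bilinear maps. -/
theorem sum_lie_casimir {M : Type*} [AddCommGroup M] [Module ℂ M] (β : L →ₗ[ℂ] L →ₗ[ℂ] M) (z : L) :
    ∑ i, (β ⁅z, b i⁆ (b i) + β (b i) ⁅z, b i⁆) = 0 := by
  have h1 : ∑ i, β ⁅z, b i⁆ (b i)
      = ∑ i, ∑ j, killingForm ℂ L ⁅z, b i⁆ (b j) • β (b j) (b i) := by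
    refine Finset.sum_congr rfl fun i _ => ?_
    conv_lhs => rw [← sum_killingForm_smul b hb ⁅z, b i⁆]
    simp
  have h2 : ∑ i, β (b i) ⁅z, b i⁆
      = ∑ i, ∑ j, killingForm ℂ L ⁅z, b j⁆ (b i) • β (b j) (b i) := by
    rw [Finset.sum_comm]
    refine Finset.sum_congr rfl fun i _ => ?_
    conv_lhs => rw [← sum_killingForm_smul b hb ⁅z, b i⁆]
    simp
  rw [Finset.sum_add_distrib, h1, h2, ← Finset.sum_add_distrib]
  refine Finset.sum_eq_zero fun i _ => ?_
  rw [← Finset.sum_add_distrib]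
  refine Finset.sum_eq_zero fun j _ => ?_
  -- The coefficients ⟨[z, bᵢ], bⱼ⟩ are antisymmetric in i and j.
  rw [← add_smul, LieModule.traceForm_apply_lie_apply' ℂ L L z (b j) (b i),
    LieModule.traceForm_comm ℂ L L (b j), add_neg_cancel, zero_smul]

/-- The Casimir operator `∑ bᵢ bᵢ` attached to a basis `b`, on a Lie module. -/
noncomputable def casimir (M : Type*) [AddCommGroup M] [Module ℂ M] [LieRingModule L M]
    [LieModule ℂ L M] : M →ₗ[ℂ] M :=
  ∑ i, LieModule.toEnd ℂ L M (b i) ∘ₗ LieModule.toEnd ℂ L M (b i)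

omit [DecidableEq ι] in
theorem casimir_apply {M : Type*} [AddCommGroup M] [Module ℂ M] [LieRingModule L M]
    [LieModule ℂ L M] (t : M) : casimir b M t = ∑ i, ⁅b i, ⁅b i, t⁆⁆ := by
  simp [casimir]

omit [DecidableEq ι] in
theorem map_casimir {M N : Type*} [AddCommGroup M] [Module ℂ M] [LieRingModule L M]
    [LieModule ℂ L M] [AddCommGroup N] [Module ℂ N] [LieRingModule L N] [LieModule ℂ L N]
    (f : M →ₗ⁅ℂ,L⁆ N) (t : M) : f (casimir b M t) = casimir b N (f t) := by
  simp [casimir_apply]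

include hb in
theorem lie_casimir {M : Type*} [AddCommGroup M] [Module ℂ M] [LieRingModule L M]
    [LieModule ℂ L M] (z : L) (t : M) : ⁅z, casimir b M t⁆ = casimir b M ⁅z, t⁆ := by
  have h := sum_lie_casimir b hb
    (LinearMap.mk₂ ℂ (fun x y : L => ⁅x, ⁅y, t⁆⁆) (by simp) (by simp) (by simp) (by simp)) z
  simp only [LinearMap.mk₂_apply] at h
  rw [casimir_apply, casimir_apply, lie_sum, ← sub_eq_zero, ← Finset.sum_sub_distrib, ← h]
  refine Finset.sum_congr rfl fun i _ => ?_
  rw [leibniz_lie z (b i), leibniz_lie z (b i) t, lie_add]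
  abel

include hb in
/-- The Casimir operator of the Killing form is the identity on the adjoint representation. -/
theorem casimir_adjoint [Module.Finite ℂ L] [LieAlgebra.IsKilling ℂ L] (y : L) :
    casimir b L y = y := by
  rw [← sub_eq_zero]
  refine (LieAlgebra.IsKilling.killingForm_nondegenerate ℂ L).1 _ fun z => ?_
  -- The trace defining ⟨y, z⟩, written in the orthonormal basis; invariance then moves it to ⟨∑
  -- [bᵢ, [bᵢ, y]], z⟩.
  have h : killingForm ℂ L y z = ∑ i, killingForm ℂ L ⁅y, ⁅z, b i⁆⁆ (b i) := by
    rw [killingForm_apply_apply, LinearMap.trace_eq_matrix_trace ℂ b, Matrix.trace]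
    refine Finset.sum_congr rfl fun i _ => ?_
    rw [Matrix.diag_apply, LinearMap.toMatrix_apply, repr_eq_killingForm b hb]
    simp
  rw [map_sub, LinearMap.sub_apply, sub_eq_zero, h, casimir_apply, map_sum, LinearMap.sum_apply]
  refine Finset.sum_congr rfl fun i _ => ?_
  rw [LieModule.traceForm_apply_lie_apply' ℂ L L (b i),
    LieModule.traceForm_apply_lie_apply' ℂ L L y, LieModule.traceForm_comm ℂ L L ⁅z, b i⁆,
    ← lie_skew y (b i), ← lie_skew z (b i)]
  simp only [map_neg, LinearMap.neg_apply, neg_neg]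

end Casimir

end JosephIdeal

namespace JosephIdeal

open Module

/-! ### The quadratic relations and their cubic consequence. -/

section Relations

variable {L : Type*} [LieRing L] [LieAlgebra ℂ L] {ι : Type*} [Fintype ι] [DecidableEq ι]
  (b : Basis ι ℂ L) (hb : ∀ i j, killingForm ℂ L (b i) (b j) = if i = j then 1 else 0)

omit [DecidableEq ι] in
theorem casimir_tmul (x y : L) : casimir b (L ⊗[ℂ] L) (x ⊗ₜ y) =
    casimir b L x ⊗ₜ y + (2 : ℂ) • ∑ i, ⁅b i, x⁆ ⊗ₜ ⁅b i, y⁆ + x ⊗ₜ casimir b L y := by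
  simp only [casimir_apply, TensorProduct.LieModule.lie_tmul_right, lie_add,
    TensorProduct.sum_tmul, TensorProduct.tmul_sum, Finset.smul_sum, ← Finset.sum_add_distrib]
  refine Finset.sum_congr rfl fun i _ => ?_
  rw [two_smul]
  abel

/-- The equivariant embedding `z ↦ ∑ [z, bᵢ] ⊗ bᵢ` of `L` in `L ⊗ L`. -/
noncomputable def adjointTensor (z : L) : L ⊗[ℂ] L := ∑ i, ⁅z, b i⁆ ⊗ₜ b i

include hb in
theorem lie_adjointTensor (x z : L) : ⁅x, adjointTensor b z⁆ = adjointTensor b ⁅x, z⁆ := by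
  have h := sum_lie_casimir b hb ((TensorProduct.mk ℂ L L) ∘ₗ LieAlgebra.ad ℂ L z) x
  simp only [LinearMap.comp_apply, TensorProduct.mk_apply] at h
  rw [adjointTensor, adjointTensor, lie_sum, ← sub_eq_zero, ← Finset.sum_sub_distrib, ← h]
  refine Finset.sum_congr rfl fun i _ => ?_
  rw [TensorProduct.LieModule.lie_tmul_right, leibniz_lie x z, TensorProduct.add_tmul]
  simp only [LieAlgebra.ad_apply]
  abel

variable [Module.Finite ℂ L] [LieAlgebra.IsKilling ℂ L]

include hb in
-- By equivariance the eigenvalue is that of C on the adjoint representation.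
theorem casimir_adjointTensor (z : L) :
    casimir b (L ⊗[ℂ] L) (adjointTensor b z) = adjointTensor b z := by
  rw [casimir_apply]
  simp only [lie_adjointTensor b hb]
  conv_rhs => rw [← casimir_adjoint b hb z, casimir_apply]
  simp only [adjointTensor, sum_lie, TensorProduct.sum_tmul]
  rw [Finset.sum_comm]

omit [Module.Finite ℂ L] [LieAlgebra.IsKilling ℂ L] in
include hb in
theorem casimir_sum_tmul_self : casimir b (L ⊗[ℂ] L) (∑ i, b i ⊗ₜ b i) = 0 := by
  rw [casimir_apply]
  refine Finset.sum_eq_zero fun i _ => ?_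
  have h := sum_lie_casimir b hb (TensorProduct.mk ℂ L L) (b i)
  simp only [TensorProduct.mk_apply] at h
  simp only [lie_sum, TensorProduct.LieModule.lie_tmul_right, h]
  simp

variable {A : Type*} [Ring A] [Algebra ℂ A] (φ : L →ₗ[ℂ] A)

/-- The linear map `x ⊗ y ↦ φ x * φ y`. -/
noncomputable def mulTensor : L ⊗[ℂ] L →ₗ[ℂ] A :=
  TensorProduct.lift ((LinearMap.mul ℂ A).compl₁₂ φ φ)

omit [Module.Finite ℂ L] [LieAlgebra.IsKilling ℂ L] in
@[simp]
theorem mulTensor_tmul (x y : L) : mulTensor φ (x ⊗ₜ y) = φ x * φ y := by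
  simp [mulTensor]

/-- The Killing form as a linear map on `L ⊗ L`. -/
noncomputable def killingTensor (L : Type*) [LieRing L] [LieAlgebra ℂ L] : L ⊗[ℂ] L →ₗ[ℂ] ℂ :=
  TensorProduct.lift (killingForm ℂ L)

omit [Module.Finite ℂ L] [LieAlgebra.IsKilling ℂ L] in
theorem killingTensor_lie (x : L) (t : L ⊗[ℂ] L) : killingTensor L ⁅x, t⁆ = 0 := by
  induction t with
  | zero => simp
  | add s t hs ht => rw [lie_add, map_add, hs, ht, add_zero]
  | tmul y z =>
    rw [TensorProduct.LieModule.lie_tmul_right, map_add]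
    simp only [killingTensor, TensorProduct.lift.tmul]
    rw [LieModule.traceForm_apply_lie_apply' ℂ L L x, neg_add_cancel]

variable (P : L ⊗[ℂ] L →ₗ⁅ℂ,L⁆ L ⊗[ℂ] L) (c : ℂ)
  (hrel : ∀ x y, φ x * φ y - mulTensor φ (P (x ⊗ₜ y)) - (1 / 2 : ℂ) • φ ⁅x, y⁆
    - algebraMap ℂ A (c * killingForm ℂ L x y) = 0)

omit [Module.Finite ℂ L] [LieAlgebra.IsKilling ℂ L] in
include hrel in
-- The defining relations extend linearly from pure tensors to all of L ⊗ L; on ker P the quadratic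
-- correction disappears and products drop to degree at most one.
theorem mulTensor_eq_of_map_eq_zero {t : L ⊗[ℂ] L} (ht : P t = 0) :
    mulTensor φ t = (1 / 2 : ℂ) • φ (LieModule.toModuleHom ℂ L L t)
      + algebraMap ℂ A (c * killingTensor L t) := by
  have h : ∀ t : L ⊗[ℂ] L, mulTensor φ t - mulTensor φ (P t)
      - (1 / 2 : ℂ) • φ (LieModule.toModuleHom ℂ L L t)
      - algebraMap ℂ A (c * killingTensor L t) = 0 := by
    intro t
    induction t with
    | zero => simp
    | add s t hs ht =>
      rw [← add_zero (0 : A)]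
      nth_rw 1 [← hs]
      rw [← ht]
      simp only [map_add, smul_add, mul_add]
      abel
    | tmul x y => simpa [killingTensor] using hrel x y
  have := h t
  rw [ht, map_zero, sub_zero, sub_sub, sub_eq_zero] at this
  exact this

variable {s : ℂ} (hP : ∀ t, casimir b (L ⊗[ℂ] L) (P t) = (2 + 2 * s) • P t)

include hb hrel hP in
-- The two inequalities separate the eigenvalue 2 + 2s of C on the image of P from 0 and 1, so P
-- kills the invariant tensor and the adjoint copy. The conclusion comes from evaluating one cubic
-- sum in two ways.
theorem smul_map_eq_zero (h0 : 2 + 2 * s ≠ 0) (h1 : 1 + 2 * s ≠ 0) (x : L) :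
    (c * (s * Fintype.card ι - 1 - s) - (2 * s - 1) / 8) • φ x = 0 := by
  have hker : ∀ (r : ℂ) t, casimir b (L ⊗[ℂ] L) t = r • t → 2 + 2 * s ≠ r → P t = 0 := by
    intro r t ht hr
    have h := hP t
    rw [← map_casimir, ht, map_smul, ← sub_eq_zero, ← sub_smul, smul_eq_zero, sub_eq_zero] at h
    exact h.resolve_left fun h => hr h.symm
  have hδ : ∀ z, ∑ i, φ ⁅z, b i⁆ * φ (b i) = (1 / 2 : ℂ) • φ z := by
    intro z
    have hz : P (adjointTensor b z) = 0 :=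
      hker 1 _ (by rw [casimir_adjointTensor b hb, one_smul])
        (fun h => h1 (by linear_combination h))
    have h := mulTensor_eq_of_map_eq_zero φ P c hrel hz
    have hbr : LieModule.toModuleHom ℂ L L (adjointTensor b z) = z := by
      conv_rhs => rw [← casimir_adjoint b hb z, casimir_apply]
      rw [adjointTensor, map_sum]
      refine Finset.sum_congr rfl fun i _ => ?_
      rw [LieModule.toModuleHom_apply, ← lie_skew, ← lie_skew (b i) z, lie_neg]
    have hkt : killingTensor L (adjointTensor b z) = 0 := by
      rw [adjointTensor, map_sum]
      refine Finset.sum_eq_zero fun i _ => ?_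
      simp only [killingTensor, TensorProduct.lift.tmul]
      rw [LieModule.traceForm_apply_lie_apply ℂ L L, lie_self, map_zero]
    rw [hbr, hkt, mul_zero, map_zero, add_zero] at h
    rw [← h, adjointTensor, map_sum]
    simp
  have hΩ : ∑ i, φ (b i) * φ (b i) = algebraMap ℂ A (c * Fintype.card ι) := by
    have h := mulTensor_eq_of_map_eq_zero φ P c hrel (t := ∑ i, b i ⊗ₜ b i)
      (hker 0 _ (by rw [casimir_sum_tmul_self b hb, zero_smul]) h0)
    simpa [killingTensor, hb] using h
  -- The relation for (C - 2 - 2s)(x ⊗ bₖ), which P kills; the cross term of C on a pure tensor is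
  -- solved for.
  have hR : ∀ k, (2 : ℂ) • ∑ i, φ ⁅b i, x⁆ * φ ⁅b i, b k⁆ = (2 * s) • (φ x * φ (b k))
      + ((1 / 2 : ℂ) * (-1 - 2 * s)) • φ ⁅x, b k⁆
      - algebraMap ℂ A ((2 + 2 * s) * c * killingForm ℂ L x (b k)) := by
    intro k
    set t : L ⊗[ℂ] L := x ⊗ₜ b k
    have hz : P (casimir b _ t - (2 + 2 * s) • t) = 0 := by
      rw [map_sub, map_casimir, hP, map_smul, sub_self]
    have h := mulTensor_eq_of_map_eq_zero φ P c hrel hz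
    have hkt : killingTensor L (casimir b _ t) = 0 := by
      rw [casimir_apply, map_sum]
      exact Finset.sum_eq_zero fun i _ => killingTensor_lie _ _
    rw [map_sub, map_sub, map_sub, map_sub, map_casimir, casimir_adjoint b hb, hkt, casimir_tmul,
      casimir_adjoint b hb, casimir_adjoint b hb] at h
    simp only [map_add, map_smul, map_sum, mulTensor_tmul, t, LieModule.toModuleHom_apply,
      killingTensor, TensorProduct.lift.tmul, smul_eq_mul] at h
    rw [← sub_eq_zero] at h ⊢
    rw [← h]
    simp only [Algebra.algebraMap_eq_smul_one]
    module
  have hsum := congrArg (fun f : ι → A => ∑ k, f k * φ (b k)) (funext hR)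
  -- Summing over k first applies `hδ` to [bᵢ, bₖ] ⊗ bₖ; a second use of `hδ` handles the sum over
  -- i.
  have hl : ∑ k, ((2 : ℂ) • ∑ i, φ ⁅b i, x⁆ * φ ⁅b i, b k⁆) * φ (b k)
      = (-1 / 2 : ℂ) • φ x := by
    have : ∀ k, ((2 : ℂ) • ∑ i, φ ⁅b i, x⁆ * φ ⁅b i, b k⁆) * φ (b k)
        = ∑ i, (2 : ℂ) • (φ ⁅b i, x⁆ * (φ ⁅b i, b k⁆ * φ (b k))) := by
      intro k
      rw [smul_mul_assoc, Finset.sum_mul, Finset.smul_sum]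
      simp only [mul_assoc]
    simp only [this]
    rw [Finset.sum_comm]
    simp only [← Finset.smul_sum, ← Finset.mul_sum, hδ, mul_smul_comm]
    have h2 : ∑ i, φ ⁅b i, x⁆ * φ (b i) = - ((1 / 2 : ℂ) • φ x) := by
      rw [← hδ x, ← Finset.sum_neg_distrib]
      refine Finset.sum_congr rfl fun i _ => ?_
      rw [← lie_skew, map_neg, neg_mul]
    rw [h2]
    module
  have hr : ∑ k, ((2 * s) • (φ x * φ (b k)) + ((1 / 2 : ℂ) * (-1 - 2 * s)) • φ ⁅x, b k⁆
      - algebraMap ℂ A ((2 + 2 * s) * c * killingForm ℂ L x (b k))) * φ (b k)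
      = (2 * s * (c * Fintype.card ι) + (1 / 2 : ℂ) * (-1 - 2 * s) * (1 / 2)
        - (2 + 2 * s) * c) • φ x := by
    have : ∑ k, killingForm ℂ L x (b k) • φ (b k) = φ x := by
      conv_rhs => rw [← sum_killingForm_smul b hb x]
      simp
    simp only [sub_mul, add_mul, smul_mul_assoc, mul_assoc, Finset.sum_add_distrib,
      Finset.sum_sub_distrib, ← Finset.smul_sum, ← Finset.mul_sum, hδ, hΩ]
    have h3 : ∑ k, algebraMap ℂ A (2 * (c * killingForm ℂ L x (b k))
        + 2 * (s * (c * killingForm ℂ L x (b k)))) * φ (b k) = ((2 + 2 * s) * c) • φ x := by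
      conv_rhs => rw [← this]
      rw [Finset.smul_sum]
      refine Finset.sum_congr rfl fun k _ => ?_
      rw [← Algebra.smul_def, smul_smul]
      congr 1
      ring
    rw [h3, Algebra.algebraMap_eq_smul_one, mul_smul_comm, mul_one]
    module
  simp only [hl, hr] at hsum
  rw [← sub_eq_zero, ← sub_smul] at hsum
  have h4 : (-1 / 2 - (2 * s * (c * Fintype.card ι) + (1 / 2 : ℂ) * (-1 - 2 * s) * (1 / 2)
        - (2 + 2 * s) * c)) = (-2) * (c * (s * Fintype.card ι - 1 - s) - (2 * s - 1) / 8) := by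
    ring
  rw [h4, mul_smul, smul_eq_zero] at hsum
  exact hsum.resolve_left (by norm_num)

end Relations

end JosephIdeal

namespace JosephIdeal

open Module LieAlgebra

/-! ### Highest root vectors and the Casimir eigenvalue on the Cartan square. -/

section HighestWeight

variable {L : Type*} [LieRing L] [LieAlgebra ℂ L]

/-- A nonzero `e ∈ L`, an eigenvector of some `ad h` with nonzero eigenvalue, is extremal of norm
`s` if `[e, [e, x]] = -s ⟨e, x⟩ e` for all `x`. The highest root vectors have this property, with
`s` the square of the length of the highest root. -/
structure IsExtremal (e : L) (s : ℂ) : Prop where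
  ne_zero : e ≠ 0
  exists_lie_eq : ∃ (h : L) (c : ℂ), c ≠ 0 ∧ ⁅h, e⁆ = c • e
  lie_lie : ∀ x, ⁅e, ⁅e, x⁆⁆ = -(s * killingForm ℂ L e x) • e

theorem eq_zero_or_re_pos_of_mem_closure {H : LieSubalgebra ℂ L} [LieRing.IsNilpotent H]
    {Φp : Set (H → ℂ)} {h₀ : H} (hΦ : ∀ f ∈ Φp, 0 < (f h₀).re) {f : H → ℂ}
    (hf : f ∈ AddSubmonoid.closure Φp) : f = 0 ∨ 0 < (f h₀).re := by
  induction hf using AddSubmonoid.closure_induction with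
  | mem f hf => exact Or.inr (hΦ f hf)
  | zero => exact Or.inl rfl
  | add f g _ _ hf hg =>
    rcases hf with rfl | hf
    · simpa using hg
    · rcases hg with rfl | hg
      · simpa using Or.inr hf
      · right
        simpa using add_pos hf hg

variable [Module.Finite ℂ L] [IsKilling ℂ L]

omit [IsKilling ℂ L] in
/-- Induction over the root space decomposition. -/
theorem mem_of_forall_rootSpace_le (H : LieSubalgebra ℂ L) [H.IsCartanSubalgebra]
    (N : Submodule ℂ L) (hN : ∀ χ : LieModule.Weight ℂ H L, ∀ x ∈ rootSpace H χ, x ∈ N) (x : L) :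
    x ∈ N := by
  have h := LieModule.iSup_genWeightSpace_eq_top' ℂ H L
  have hx : x ∈ (⨆ χ : LieModule.Weight ℂ H L, LieModule.genWeightSpace L χ) := by
    rw [h]; exact LieSubmodule.mem_top x
  rw [← LieSubmodule.mem_toSubmodule, LieSubmodule.iSup_toSubmodule] at hx
  exact (iSup_le fun χ y hy => hN χ y hy : (⨆ χ : LieModule.Weight ℂ H L,
    (LieModule.genWeightSpace L χ).toSubmodule) ≤ N) hx

theorem exists_isNonZero_weight [Nontrivial L] (H : LieSubalgebra ℂ L) [H.IsCartanSubalgebra] :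
    ∃ α : LieModule.Weight ℂ H L, α.IsNonZero := by
  by_contra! hcon
  have h0 : ∀ (h : H) (x : L), ⁅(h : L), x⁆ = 0 := by
    intro h x
    refine mem_of_forall_rootSpace_le H (LinearMap.ker (ad ℂ L h)) (fun χ y hy => ?_) x
    have hχ : (χ : H → ℂ) = 0 := by
      by_contra hne
      exact hne (hcon χ)
    have := IsKilling.lie_eq_smul_of_mem_rootSpace hy h
    rw [hχ, Pi.zero_apply, zero_smul] at this
    exact this
  have hH : ∀ x : L, x ∈ H := by
    intro x
    rw [← LieSubalgebra.IsCartanSubalgebra.self_normalizing (H := H),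
      LieSubalgebra.mem_normalizer_iff']
    intro y hy
    rw [h0 ⟨y, hy⟩ x]
    exact H.zero_mem
  have hab : IsLieAbelian L := ⟨fun x y => h0 ⟨x, hH x⟩ y⟩
  exact not_subsingleton L ((IsKilling.isLieAbelian_iff_subsingleton ℂ L).1 hab)

theorem exists_isExtremal_tmul_mem {W : LieSubmodule ℂ L (L ⊗[ℂ] L)} (hW : IsCartanSquare L W) :
    ∃ (e : L) (s : ℂ), IsExtremal e s ∧ e ⊗ₜ e ∈ W ∧ e ⊗ₜ[ℂ] e ≠ 0 := by
  obtain ⟨hirr, H, hH, Φp, θ, ⟨h₀, hh₀, rfl⟩, ⟨⟨μθ, rfl⟩, hθ⟩, ⟨μW, hμW⟩, -⟩ := hW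
  set Φp := {f : H → ℂ | ∃ α : LieModule.Weight ℂ H L,
    α.IsNonZero ∧ 0 < (α h₀).re ∧ f = (α : H → ℂ)}
  -- Real parts at h₀ replace the partial order on weights: θ - μ either vanishes or has positive
  -- real part there.
  have hcl : ∀ f ∈ AddSubmonoid.closure Φp, f = 0 ∨ 0 < (f h₀).re := fun f hf =>
    eq_zero_or_re_pos_of_mem_closure (by rintro f ⟨α, -, h, rfl⟩; exact h) hf
  have hWn : Nontrivial W := (LieSubmodule.nontrivial_iff ℂ L W).1 hirr.toNontrivial
  have hLn : Nontrivial L := by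
    by_contra hL
    rw [not_nontrivial_iff_subsingleton] at hL
    have : Subsingleton (L ⊗[ℂ] L) := ⟨fun s t => by
      have h : ∀ t : L ⊗[ℂ] L, t = 0 := fun t => by
        induction t with
        | zero => rfl
        | add s t hs ht => rw [hs, ht, add_zero]
        | tmul x y => rw [Subsingleton.elim x 0, TensorProduct.zero_tmul]
      rw [h s, h t]⟩
    exact not_subsingleton W inferInstance
  -- If θ were 0, some root and its negative would both have positive real part at h₀.
  have hθ0 : μθ.IsNonZero := by
    intro h0
    obtain ⟨α, hα⟩ := exists_isNonZero_weight H
    have h1 := hcl _ (hθ α)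
    have h2 := hcl _ (hθ (-α))
    rw [h0.eq, LieModule.Weight.coe_neg, sub_neg_eq_add, zero_add] at h2
    rw [h0.eq, zero_sub, neg_eq_zero] at h1
    rcases h1 with h1 | h1
    · exact hα h1
    · rcases h2 with h2 | h2
      · exact hα h2
      · simp at h1
        linarith
  obtain ⟨⟨e, he⟩, hene, hspan⟩ :=
    finrank_eq_one_iff'.1 (IsKilling.finrank_rootSpace_eq_one μθ hθ0)
  have hene : e ≠ 0 := fun h => hene (Subtype.ext h)
  have hspan : ∀ x ∈ rootSpace H μθ, ∃ r : ℂ, x = r • e := by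
    intro x hx
    obtain ⟨r, hr⟩ := hspan ⟨x, hx⟩
    exact ⟨r, (congrArg Subtype.val hr).symm⟩
  have hlie : ∀ χ : H → ℂ, ∀ x ∈ rootSpace H χ, ⁅(h₀ : L), x⁆ = χ h₀ • x :=
    fun χ x hx => IsKilling.lie_eq_smul_of_mem_rootSpace hx h₀
  -- If (ad e)² is nonzero on the root space of μ, then 2θ + μ and -μ are both weights. Neither
  -- exceeds θ, which forces μ = -θ, and the image lies in the line of e.
  have hee : ∀ x, ∃ r : ℂ, ⁅e, ⁅e, x⁆⁆ = r • e := by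
    intro x
    have : x ∈ (ℂ ∙ e).comap (ad ℂ L e ∘ₗ ad ℂ L e) := by
      refine mem_of_forall_rootSpace_le H _ (fun μ y hy => ?_) x
      have hy2 := lie_mem_genWeightSpace_of_mem_genWeightSpace he
        (lie_mem_genWeightSpace_of_mem_genWeightSpace he hy)
      rw [Submodule.mem_comap, LinearMap.comp_apply, ad_apply, ad_apply]
      by_cases hz : ⁅e, ⁅e, y⁆⁆ = 0
      · rw [hz]; exact zero_mem _
      let ν : LieModule.Weight ℂ H L := ⟨μθ + (μθ + μ), fun hbot => hz (by
        rw [hbot] at hy2; exact (LieSubmodule.mem_bot _).1 hy2)⟩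
      have h1 := hcl _ (hθ ν)
      have h2 := hcl _ (hθ (-μ))
      have hν : (μθ : H → ℂ) - ν = -(μθ + μ) := by
        change (μθ : H → ℂ) - (μθ + (μθ + μ)) = _
        abel
      rw [hν, neg_eq_zero] at h1
      rw [LieModule.Weight.coe_neg, sub_neg_eq_add] at h2
      have h3 : (μθ : H → ℂ) + μ = 0 := by
        rcases h1 with h1 | h1
        · exact h1
        · rcases h2 with h2 | h2
          · exact h2
          · simp only [Pi.neg_apply, Complex.neg_re] at h1
            linarith
      rw [h3, add_zero] at hy2
      obtain ⟨r, hr⟩ := hspan _ hy2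
      exact Submodule.mem_span_singleton.2 ⟨r, hr.symm⟩
    obtain ⟨r, hr⟩ := Submodule.mem_span_singleton.1 this
    exact ⟨r, hr.symm⟩
  choose l hl using hee
  -- (ad e)² is self-adjoint for the Killing form, so the functional l is proportional to ⟨e, ·⟩;
  -- the ratio gives s.
  have hsymm : ∀ x y, l x * killingForm ℂ L e y = l y * killingForm ℂ L e x := by
    intro x y
    have h : killingForm ℂ L ⁅e, ⁅e, x⁆⁆ y = killingForm ℂ L ⁅e, ⁅e, y⁆⁆ x := by
      rw [LieModule.traceForm_apply_lie_apply', LieModule.traceForm_apply_lie_apply', neg_neg,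
        LieModule.traceForm_comm]
    rw [hl, hl] at h
    simpa using h
  obtain ⟨y, hy⟩ : ∃ y, killingForm ℂ L e y ≠ 0 := by
    by_contra! hy
    exact hene ((IsKilling.killingForm_nondegenerate ℂ L).1 e hy)
  refine ⟨e, -(l y / killingForm ℂ L e y), ⟨hene, ⟨h₀, μθ h₀, ?_, hlie _ e he⟩, ?_⟩, ?_⟩
  · intro h
    exact hh₀ μθ hθ0 (by rw [h, Complex.zero_re])
  · intro x
    rw [hl x]
    congr 1
    have := hsymm x y
    field_simp
    linear_combination this
  obtain ⟨⟨w, hw⟩, hwe⟩ := (μW.hasEigenvalueAt h₀).exists_hasEigenvector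
  set T := LieModule.toEnd ℂ L (L ⊗[ℂ] L) h₀
  have hTw : w ∈ T.eigenspace (2 * μθ h₀) := by
    rw [End.mem_eigenspace_iff]
    have := congrArg Subtype.val (End.mem_eigenspace_iff.1 hwe.1)
    rw [← hμW] at this
    simpa [T] using this
  have hw0 : w ≠ 0 := fun h => hwe.2 (Subtype.ext h)
  -- Among sums of two weights, the value 2θ(h₀) arises only as θ + θ. Hence the eigenspace of h₀
  -- containing the weight vector w of W is the line of e ⊗ e.
  have htop : ∀ t : L ⊗[ℂ] L,
      t ∈ (ℂ ∙ e ⊗ₜ[ℂ] e) ⊔ ⨆ (a) (_ : a ≠ 2 * μθ h₀), T.eigenspace a := by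
    intro t
    induction t with
    | zero => exact zero_mem _
    | add s t hs ht => exact add_mem hs ht
    | tmul x y =>
      set S := (ℂ ∙ e ⊗ₜ[ℂ] e) ⊔ ⨆ (a) (_ : a ≠ 2 * μθ h₀), T.eigenspace a
      refine mem_of_forall_rootSpace_le H (S.comap ((TensorProduct.mk ℂ L L).flip y))
        (fun μ x hx => ?_) x
      refine mem_of_forall_rootSpace_le H (S.comap (TensorProduct.mk ℂ L L x))
        (fun ν y hy => ?_) y
      change x ⊗ₜ y ∈ S
      have hT : x ⊗ₜ y ∈ T.eigenspace (μ h₀ + ν h₀) := by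
        rw [End.mem_eigenspace_iff]
        simp only [T, LieModule.toEnd_apply_apply, TensorProduct.LieModule.lie_tmul_right]
        rw [hlie _ x hx, hlie _ y hy, add_smul, TensorProduct.smul_tmul', TensorProduct.tmul_smul]
      by_cases hne : μ h₀ + ν h₀ = 2 * μθ h₀
      · have hre := congrArg Complex.re hne
        have h1 := hcl _ (hθ μ)
        have h2 := hcl _ (hθ ν)
        simp only [Pi.sub_apply, Complex.sub_re] at h1 h2
        have hre' : (μ h₀).re + (ν h₀).re = 2 * (μθ h₀).re := by simpa using hre
        have hle : ∀ χ : LieModule.Weight ℂ H L, (χ h₀).re ≤ (μθ h₀).re := by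
          intro χ
          rcases hcl _ (hθ χ) with h | h
          · rw [sub_eq_zero.1 h]
          · simp only [Pi.sub_apply, Complex.sub_re] at h
            linarith
        have := hle μ
        have := hle ν
        have hμ : (μ : H → ℂ) = μθ := by
          rcases h1 with h1 | h1
          · exact (sub_eq_zero.1 h1).symm
          · linarith
        have hν : (ν : H → ℂ) = μθ := by
          rcases h2 with h2 | h2
          · exact (sub_eq_zero.1 h2).symm
          · linarith
        rw [hμ] at hx
        rw [hν] at hy
        obtain ⟨r, rfl⟩ := hspan x hx
        obtain ⟨r', rfl⟩ := hspan y hy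
        rw [TensorProduct.smul_tmul_smul]
        exact Submodule.mem_sup_left
          (Submodule.smul_mem _ _ (Submodule.mem_span_singleton_self _))
      · exact Submodule.mem_sup_right
          (Submodule.mem_iSup_of_mem _ (Submodule.mem_iSup_of_mem hne hT))
  obtain ⟨u, hu, v, hv, huv⟩ := Submodule.mem_sup.1 (htop w)
  obtain ⟨r, rfl⟩ := Submodule.mem_span_singleton.1 hu
  have hTe : e ⊗ₜ e ∈ T.eigenspace (2 * μθ h₀) := by
    rw [End.mem_eigenspace_iff]
    simp only [T, LieModule.toEnd_apply_apply, TensorProduct.LieModule.lie_tmul_right]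
    rw [hlie _ e he, two_mul, add_smul, TensorProduct.tmul_smul, ← TensorProduct.smul_tmul']
  have hv0 : v = 0 := by
    refine Submodule.disjoint_def.1 (T.eigenspaces_iSupIndep (2 * μθ h₀)) v ?_ hv
    rw [← sub_eq_iff_eq_add'.2 huv.symm]
    exact sub_mem hTw (Submodule.smul_mem _ _ hTe)
  rw [hv0, add_zero] at huv
  have hr : r ≠ 0 := by
    rintro rfl
    exact hw0 (by rw [← huv, zero_smul])
  refine ⟨?_, fun h => hw0 (by rw [← huv, h, smul_zero])⟩
  have : e ⊗ₜ[ℂ] e = r⁻¹ • w := by rw [← huv, smul_smul, inv_mul_cancel₀ hr, one_smul]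
  rw [this]
  exact W.smul_mem _ hw

variable {ι : Type*} [Fintype ι] [DecidableEq ι]
  (b : Basis ι ℂ L) (hb : ∀ i j, killingForm ℂ L (b i) (b j) = if i = j then 1 else 0)

include hb in
-- Expanding the second factor of ∑ [bᵢ, e] ⊗ [bᵢ, e] in the basis and using invariance turns the
-- first factor into [[e, bⱼ], e], which extremality evaluates.
theorem IsExtremal.casimir_tmul_self {e : L} {s : ℂ} (he : IsExtremal e s) :
    casimir b (L ⊗[ℂ] L) (e ⊗ₜ e) = (2 + 2 * s) • e ⊗ₜ e := by
  have h : ∑ i, ⁅b i, e⁆ ⊗ₜ[ℂ] ⁅b i, e⁆ = s • e ⊗ₜ e := by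
    have h1 : ∀ i, ⁅b i, e⁆ ⊗ₜ[ℂ] ⁅b i, e⁆ =
        ∑ j, (killingForm ℂ L ⁅e, b j⁆ (b i) • ⁅b i, e⁆) ⊗ₜ[ℂ] b j := by
      intro i
      rw [← congrArg (⁅b i, e⁆ ⊗ₜ[ℂ] ·) (sum_killingForm_smul b hb ⁅b i, e⁆),
        TensorProduct.tmul_sum]
      refine Finset.sum_congr rfl fun j _ => ?_
      rw [TensorProduct.smul_tmul, LieModule.traceForm_apply_lie_apply,
        LieModule.traceForm_comm ℂ L L (b i)]
    have h2 : ∀ j, ∑ i, killingForm ℂ L ⁅e, b j⁆ (b i) • ⁅b i, e⁆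
        = (s * killingForm ℂ L e (b j)) • e := by
      intro j
      have := congrArg (fun x => ⁅x, e⁆) (sum_killingForm_smul b hb ⁅e, b j⁆)
      simp only [sum_lie, smul_lie] at this
      rw [this, ← lie_skew, he.lie_lie, neg_smul, neg_neg]
    simp only [h1]
    rw [Finset.sum_comm]
    have h3 : ∀ j, ((s * killingForm ℂ L e (b j)) • e) ⊗ₜ[ℂ] b j
        = s • e ⊗ₜ (killingForm ℂ L e (b j) • b j) := fun j => by
      rw [mul_smul, ← TensorProduct.smul_tmul', TensorProduct.smul_tmul]
    simp only [← TensorProduct.sum_tmul, h2, h3]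
    rw [← Finset.smul_sum, ← TensorProduct.tmul_sum, sum_killingForm_smul b hb]
  rw [casimir_tmul, casimir_adjoint b hb, h]
  module

include hb in
-- The eigenspace of C for 2 + 2s is a submodule that contains e ⊗ e, hence the whole irreducible
-- image of P.
theorem IsCartanProjection.exists_isExtremal {P : L ⊗[ℂ] L →ₗ⁅ℂ,L⁆ L ⊗[ℂ] L}
    (hP : IsCartanProjection L P) : ∃ (e : L) (s : ℂ), IsExtremal e s ∧
      ∀ t, casimir b (L ⊗[ℂ] L) (P t) = (2 + 2 * s) • P t := by
  obtain ⟨e, s, he, heW, hne⟩ := exists_isExtremal_tmul_mem hP.2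
  have hirr := hP.2.1
  refine ⟨e, s, he, fun t => ?_⟩
  let E : LieSubmodule ℂ L (L ⊗[ℂ] L) :=
    { LinearMap.ker (casimir b (L ⊗[ℂ] L) - (2 + 2 * s) • LinearMap.id) with
      lie_mem := by
        intro x m hm
        simp only [AddSubsemigroup.mem_carrier, AddSubmonoid.mem_toSubsemigroup,
          Submodule.mem_toAddSubmonoid, LinearMap.mem_ker, LinearMap.sub_apply,
          LinearMap.smul_apply, LinearMap.id_apply, sub_eq_zero] at hm ⊢
        rw [← lie_casimir b hb, hm, lie_smul] }
  have hE : ∀ m, m ∈ E ↔ casimir b (L ⊗[ℂ] L) m = (2 + 2 * s) • m := by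
    intro m
    change casimir b (L ⊗[ℂ] L) m - (2 + 2 * s) • m = 0 ↔ _
    rw [sub_eq_zero]
  rw [← hE]
  rcases hirr.eq_bot_or_eq_top (E.comap P.range.incl) with h | h
  · exfalso
    have : (⟨e ⊗ₜ e, heW⟩ : P.range) ∈ E.comap P.range.incl :=
      (hE _).2 (he.casimir_tmul_self b hb)
    rw [h, LieSubmodule.mem_bot] at this
    exact hne (congrArg Subtype.val this)
  · have : (⟨P t, t, rfl⟩ : P.range) ∈ E.comap P.range.incl := by
      rw [h]; exact LieSubmodule.mem_top _
    exact this

end HighestWeight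

end JosephIdeal

namespace JosephIdeal

open Module LieAlgebra

/-! ### From the vanishing of the generators to the ideals and the quotient. -/

section Ideals

attribute [local instance] LieRing.ofAssociativeRing

variable {L : Type*} [LieRing L] [LieAlgebra ℂ L]

/-- Modulo I a tensor equals its constant part; products follow from ab - a₀b₀ = (a - a₀)b + a₀(b -
b₀). -/
theorem sub_algebraMapInv_mem {I : TwoSidedIdeal (TensorAlgebra ℂ L)}
    (hI : ∀ x, TensorAlgebra.ι ℂ x ∈ I) (t : TensorAlgebra ℂ L) :
    t - algebraMap ℂ _ (TensorAlgebra.algebraMapInv t) ∈ I := by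
  induction t using TensorAlgebra.induction with
  | algebraMap r => simp [TensorAlgebra.algebraMapInv, zero_mem]
  | ι x => simpa [TensorAlgebra.algebraMapInv] using hI x
  | add a b ha hb =>
    have := I.add_mem ha hb
    convert this using 1
    simp only [map_add]
    abel
  | mul a b ha hb =>
    have := I.add_mem (I.mul_mem_right _ b ha)
      (I.mul_mem_left (algebraMap ℂ _ (TensorAlgebra.algebraMapInv a)) _ hb)
    convert this using 1
    simp only [map_mul]
    noncomm_ring

theorem tensorSquareIncl_mem {I : TwoSidedIdeal (TensorAlgebra ℂ L)}
    (hI : ∀ x, TensorAlgebra.ι ℂ x ∈ I) (t : L ⊗[ℂ] L) : tensorSquareIncl L t ∈ I := by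
  induction t with
  | zero => rw [map_zero]; exact zero_mem _
  | add s t hs ht => rw [map_add]; exact add_mem hs ht
  | tmul x y => exact I.mul_mem_right _ _ (hI x)

theorem lift_zero_mkAlgHom (t : TensorAlgebra ℂ L) :
    UniversalEnvelopingAlgebra.lift ℂ (0 : L →ₗ⁅ℂ⁆ ℂ) (UniversalEnvelopingAlgebra.mkAlgHom ℂ L t)
      = TensorAlgebra.algebraMapInv t := by
  have : (UniversalEnvelopingAlgebra.lift ℂ (0 : L →ₗ⁅ℂ⁆ ℂ)).comp
      (UniversalEnvelopingAlgebra.mkAlgHom ℂ L) = TensorAlgebra.algebraMapInv := by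
    ext x
    simp [TensorAlgebra.algebraMapInv]
  exact DFunLike.congr_fun this t

theorem mkAlgHom_surjective :
    Function.Surjective (UniversalEnvelopingAlgebra.mkAlgHom ℂ L) :=
  RingCon.mkₐ_surjective _

theorem mkAlgHom_mem_envelopingIdeal {c : ℂ} {t : TensorAlgebra ℂ L} (ht : t ∈ tensorIdeal L c) :
    UniversalEnvelopingAlgebra.mkAlgHom ℂ L t ∈ envelopingIdeal L c :=
  TwoSidedIdeal.subset_span ⟨t, ht, rfl⟩

theorem isCoatom_augmentationIdeal : IsCoatom (augmentationIdeal L) := by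
  set ε := UniversalEnvelopingAlgebra.lift ℂ (0 : L →ₗ⁅ℂ⁆ ℂ)
  have hmem : ∀ u, u ∈ augmentationIdeal L ↔ ε u = 0 := fun u => TwoSidedIdeal.mem_ker _
  refine ⟨fun h => ?_, fun J hJ => ?_⟩
  · have : (1 : UniversalEnvelopingAlgebra ℂ L) ∈ augmentationIdeal L := by
      rw [h]; exact TwoSidedIdeal.mem_top _
    rw [hmem, map_one] at this
    exact one_ne_zero this
  · obtain ⟨u, huJ, hu⟩ := Set.exists_of_ssubset ((TwoSidedIdeal.lt_iff _ _).1 hJ)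
    have hεu : ε u ≠ 0 := fun h => hu ((hmem u).2 h)
    rw [← TwoSidedIdeal.one_mem_iff]
    have h1 : algebraMap ℂ _ (ε u) - u ∈ J := by
      refine hJ.le ((hmem _).2 ?_)
      simp
    have h2 : algebraMap ℂ _ (ε u) ∈ J := by
      have := J.add_mem h1 huJ
      rwa [sub_add_cancel] at this
    have h3 := J.mul_mem_left (algebraMap ℂ _ (ε u)⁻¹) _ h2
    rwa [← map_mul, inv_mul_cancel₀ hεu, map_one] at h3

theorem envelopingIdeal_zero_le : envelopingIdeal L 0 ≤ augmentationIdeal L := by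
  have hle : tensorIdeal L 0 ≤
      TwoSidedIdeal.ker (TensorAlgebra.algebraMapInv (R := ℂ) (M := L)) := by
    refine TwoSidedIdeal.span_le.2 ?_
    rintro _ ⟨X, Y, rfl⟩
    have hι : ∀ x, TensorAlgebra.ι ℂ x ∈
        TwoSidedIdeal.ker (TensorAlgebra.algebraMapInv (R := ℂ) (M := L)) := fun x => by
      simp [TwoSidedIdeal.mem_ker, TensorAlgebra.algebraMapInv]
    have hsq := fun t => (TwoSidedIdeal.mem_ker _).1 (tensorSquareIncl_mem hι t)
    have hbr := (TwoSidedIdeal.mem_ker _).1 (hι ⁅X, Y⁆)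
    rw [SetLike.mem_coe, TwoSidedIdeal.mem_ker, josephGenerator]
    simp [hsq, hbr]
  refine TwoSidedIdeal.span_le.2 ?_
  rintro _ ⟨t, ht, rfl⟩
  rw [SetLike.mem_coe, augmentationIdeal, TwoSidedIdeal.mem_ker, lift_zero_mkAlgHom]
  exact (TwoSidedIdeal.mem_ker _).1 (hle ht)

/-- The algebra `A_c` is at most one-dimensional, and the ideal `I_c` has in the universal enveloping
algebra the image this forces: everything if `c ≠ 0`, the maximal augmentation ideal if `c = 0`. -/
def IsTrivialQuotient (L : Type*) [LieRing L] [LieAlgebra ℂ L] (c : ℂ) : Prop :=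
  (c ≠ 0 → envelopingIdeal L c = ⊤) ∧
  (c = 0 → envelopingIdeal L c = augmentationIdeal L ∧ IsCoatom (augmentationIdeal L)) ∧
  Module.Finite ℂ (quotientAlgebra L c) ∧ Module.finrank ℂ (quotientAlgebra L c) ≤ 1

/-- If the generators of the tensor algebra lie in `I_c`, the quotient is trivial. -/
theorem isTrivialQuotient_of_ι_mem [Nontrivial L] [Module.Finite ℂ L] [IsKilling ℂ L] {c : ℂ}
    (hI : ∀ x, TensorAlgebra.ι ℂ x ∈ tensorIdeal L c) :
    IsTrivialQuotient L c := by
  have hspan : ∀ w : quotientAlgebra L c, ∃ r : ℂ, r • (1 : quotientAlgebra L c) = w := by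
    intro w
    obtain ⟨t, rfl⟩ := RingCon.mkₐ_surjective (α := ℂ) (tensorIdeal L c).ringCon w
    refine ⟨TensorAlgebra.algebraMapInv t, ?_⟩
    rw [← Algebra.algebraMap_eq_smul_one, ← AlgHom.commutes (RingCon.mkₐ ℂ _)]
    exact ((RingCon.eq _).2 ((TwoSidedIdeal.rel_iff _ _ _).2 (sub_algebraMapInv_mem hI t))).symm
  refine ⟨fun hc => ?_, fun hc => ⟨?_, isCoatom_augmentationIdeal⟩, ?_, finrank_le_one 1 hspan⟩
  -- With ⟨x, y⟩ ≠ 0, every other term of the generator is already in the ideal, so the unit c⟨x, y⟩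
  -- is too.
  · obtain ⟨x, hx⟩ := exists_ne (0 : L)
    obtain ⟨y, hy⟩ : ∃ y, killingForm ℂ L x y ≠ 0 := by
      by_contra! hy
      exact hx ((IsKilling.killingForm_nondegenerate ℂ L).1 x hy)
    have hne : c * killingForm ℂ L x y ≠ 0 := mul_ne_zero hc hy
    have hgen : josephGenerator L c x y ∈ tensorIdeal L c := TwoSidedIdeal.subset_span ⟨x, y, rfl⟩
    have hmem : algebraMap ℂ (TensorAlgebra ℂ L) (c * killingForm ℂ L x y) ∈ tensorIdeal L c := by
      have h1 := sub_mem (tensorSquareIncl_mem hI (x ⊗ₜ[ℂ] y))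
        (tensorSquareIncl_mem hI (cartanProjection L (x ⊗ₜ[ℂ] y)))
      have h2 := (tensorIdeal L c).mul_mem_left (algebraMap ℂ _ (1 / 2 : ℂ)) _ (hI ⁅x, y⁆)
      rw [← Algebra.smul_def] at h2
      have := sub_mem (sub_mem h1 h2) hgen
      rwa [josephGenerator, sub_sub_cancel] at this
    have hone := (tensorIdeal L c).mul_mem_left (algebraMap ℂ _ (c * killingForm ℂ L x y)⁻¹) _ hmem
    rw [← map_mul, inv_mul_cancel₀ hne, map_one] at hone
    rw [← TwoSidedIdeal.one_mem_iff]
    simpa using mkAlgHom_mem_envelopingIdeal hone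
  · subst hc
    refine le_antisymm envelopingIdeal_zero_le fun u hu => ?_
    obtain ⟨t, rfl⟩ := mkAlgHom_surjective u
    rw [augmentationIdeal, TwoSidedIdeal.mem_ker, lift_zero_mkAlgHom] at hu
    have := sub_algebraMapInv_mem hI t
    rw [hu, map_zero, sub_zero] at this
    exact mkAlgHom_mem_envelopingIdeal this
  · exact Module.Finite.of_surjective (LinearMap.toSpanSingleton ℂ (quotientAlgebra L c) 1) hspan

/-- The quotient is trivial for a Killing Lie algebra whose extremal elements all have norm `s`, for
all but one value of `c`. -/
theorem isTrivialQuotient_of_forall_isExtremal [Nontrivial L] [Module.Finite ℂ L] [IsKilling ℂ L]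
    {s : ℂ} (hs : ∀ (e : L) (r : ℂ), IsExtremal e r → r = s) (h0 : 2 + 2 * s ≠ 0)
    (h1 : 1 + 2 * s ≠ 0) {c : ℂ}
    (hc : c * (s * finrank ℂ L - 1 - s) - (2 * s - 1) / 8 ≠ 0) :
    IsTrivialQuotient L c := by
  obtain ⟨b, hb⟩ := exists_orthonormal_basis_killingForm L
  have hP : ∀ t, casimir b (L ⊗[ℂ] L) (cartanProjection L t)
      = (2 + 2 * s) • cartanProjection L t := by
    by_cases h : ∃ P, IsCartanProjection L P
    · obtain ⟨e, r, he, hr⟩ := h.choose_spec.exists_isExtremal b hb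
      rw [hs e r he] at hr
      rw [cartanProjection, dif_pos h]
      exact hr
    -- The default projection 0 satisfies the eigenvalue equation trivially, so existence of the
    -- Cartan projection is not needed.
    · intro t
      rw [cartanProjection, dif_neg h]
      simp
  refine isTrivialQuotient_of_ι_mem fun x => ?_
  set π : TensorAlgebra ℂ L →ₐ[ℂ] quotientAlgebra L c := RingCon.mkₐ ℂ _
  have hπ : ∀ t, π t = 0 ↔ t ∈ tensorIdeal L c := by
    intro t
    rw [TwoSidedIdeal.mem_iff, ← RingCon.eq]
    rfl
  set φ : L →ₗ[ℂ] quotientAlgebra L c := π.toLinearMap ∘ₗ TensorAlgebra.ι ℂ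
  have hφ : ∀ t, π (tensorSquareIncl L t) = mulTensor φ t := by
    intro t
    induction t with
    | zero => simp
    | add s t hs ht => rw [map_add, map_add, hs, ht, map_add]
    | tmul x y => simp [tensorSquareIncl, φ]
  have hrel : ∀ x y, φ x * φ y - mulTensor φ (cartanProjection L (x ⊗ₜ y))
      - (1 / 2 : ℂ) • φ ⁅x, y⁆ - algebraMap ℂ _ (c * killingForm ℂ L x y) = 0 := by
    intro x y
    have := (hπ _).2 (TwoSidedIdeal.subset_span ⟨x, y, rfl⟩ :
      josephGenerator L c x y ∈ tensorIdeal L c)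
    rw [josephGenerator, map_sub, map_sub, map_sub, hφ, hφ, map_smul, AlgHom.commutes,
      mulTensor_tmul] at this
    exact this
  have hx := smul_map_eq_zero b hb φ (cartanProjection L) c hrel hP h0 h1 x
  rw [Fintype.card_fin] at hx
  exact (hπ _).1 ((smul_eq_zero.1 hx).resolve_left hc)

end Ideals

end JosephIdeal

namespace JosephIdeal

open Module LieAlgebra Matrix

/-! ### Traces and contractions with matrix units. -/

section Matrices

attribute [local instance 100] LieRing.ofAssociativeRing

variable {n : Type*} [Fintype n] [DecidableEq n]

theorem trace_end_matrix (F : Matrix n n ℂ →ₗ[ℂ] Matrix n n ℂ) :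
    LinearMap.trace ℂ _ F = ∑ i, ∑ j, F (single i j 1) i j := by
  rw [LinearMap.trace_eq_matrix_trace ℂ (Matrix.stdBasis ℂ n n), Matrix.trace,
    Fintype.sum_prod_type]
  refine Finset.sum_congr rfl fun i _ => Finset.sum_congr rfl fun j _ => ?_
  rw [Matrix.diag_apply, LinearMap.toMatrix_apply, Matrix.stdBasis_eq_single]
  rfl

theorem sum_mul_single_mul_apply (A B : Matrix n n ℂ) :
    ∑ i, ∑ j, (A * single i j 1 * B : Matrix n n ℂ) i j = A.trace * B.trace := by
  simp only [Matrix.trace, Finset.sum_mul_sum, Matrix.diag_apply]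
  refine Finset.sum_congr rfl fun i _ => Finset.sum_congr rfl fun j _ => ?_
  simp [Matrix.mul_apply, Matrix.single_apply, Finset.sum_ite_eq, ite_and]

theorem sum_mul_single_swap_mul_apply (A B : Matrix n n ℂ) :
    ∑ i, ∑ j, (A * single j i 1 * B : Matrix n n ℂ) i j = (A * Bᵀ).trace := by
  simp only [Matrix.trace, Matrix.diag_apply]
  refine Finset.sum_congr rfl fun i _ => ?_
  rw [Matrix.mul_apply]
  refine Finset.sum_congr rfl fun j _ => ?_
  simp [Matrix.mul_apply, Matrix.single_apply, Finset.sum_ite_eq, ite_and]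

/-- This and the next two contractions apply to an identity linear in M: put M = A Eⱼᵢ, multiply by
Eᵢⱼ on the left and sum. -/
theorem sum_single_mul_single (X Y : Matrix n n ℂ) :
    ∑ i, ∑ j, single i j 1 * (X * single j i 1 * Y) = X.trace • Y := by
  ext k l
  simp [Matrix.sum_apply, Matrix.mul_apply, Matrix.single_apply, Matrix.trace, ite_and,
    Finset.sum_mul]

theorem sum_single_mul_single_swap (X Y : Matrix n n ℂ) :
    ∑ i, ∑ j, single i j 1 * (X * single i j 1 * Y) = Xᵀ * Y := by
  ext k l
  simp [Matrix.sum_apply, Matrix.mul_apply, Matrix.single_apply, ite_and]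

theorem sum_trace_smul_single_mul (X Y : Matrix n n ℂ) :
    ∑ i, ∑ j, single i j 1 * ((X * single j i 1).trace • Y) = X * Y := by
  ext k l
  simp [Matrix.sum_apply, Matrix.mul_apply, Matrix.single_apply, Matrix.trace, ite_and]

theorem eq_zero_or_eq_zero_of_forall_mul_mul {X Y : Matrix n n ℂ}
    (h : ∀ A, X * A * Y = 0) : X = 0 ∨ Y = 0 := by
  by_contra! hc
  obtain ⟨hX, hY⟩ := hc
  obtain ⟨i, j, hij⟩ : ∃ i j, X i j ≠ 0 := by
    by_contra! h0; exact hX (Matrix.ext h0)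
  obtain ⟨k, l, hkl⟩ : ∃ k l, Y k l ≠ 0 := by
    by_contra! h0; exact hY (Matrix.ext h0)
  have := congrFun (congrFun (h (single j k 1)) i) l
  simp [Matrix.mul_apply, Matrix.single_apply, ite_and] at this
  tauto

theorem eq_zero_of_forall_trace_mul {X : Matrix n n ℂ} (h : ∀ A, (X * A).trace = 0) : X = 0 := by
  ext i j
  have := h (single j i 1)
  simpa [Matrix.trace, Matrix.mul_apply, Matrix.single_apply, ite_and] using this

/-- An eigenvector of `ad h` for a nonzero eigenvalue is nilpotent. -/
theorem exists_pow_eq_zero_of_lie_eq_smul {e h : Matrix n n ℂ} {c : ℂ} (hc : c ≠ 0)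
    (he : h * e - e * h = c • e) : ∃ k, e ^ k = 0 := by
  by_contra! hne
  -- Nonzero powers of e would be eigenvectors of ad h for the infinitely many eigenvalues kc.
  have hpow : ∀ k : ℕ, h * e ^ k - e ^ k * h = (k * c) • e ^ k := by
    intro k
    induction k with
    | zero => simp
    | succ k ih =>
      have : h * e ^ (k + 1) - e ^ (k + 1) * h
          = (h * e ^ k - e ^ k * h) * e + e ^ k * (h * e - e * h) := by
        rw [pow_succ]; noncomm_ring
      rw [this, ih, he, smul_mul_assoc, mul_smul_comm, ← pow_succ, ← add_smul]
      push_cast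
      ring_nf
  set T : End ℂ (Matrix n n ℂ) := LinearMap.mulLeft ℂ h - LinearMap.mulRight ℂ h
  have hT : ∀ k : ℕ, T.HasEigenvalue (k * c) := fun k =>
    End.hasEigenvalue_of_hasEigenvector (x := e ^ k)
      ⟨End.mem_eigenspace_iff.2 (by simpa [T] using hpow k), hne k⟩
  refine Set.infinite_of_injective_forall_mem (f := fun k : ℕ => (k : ℂ) * c) ?_ hT
    (End.finite_hasEigenvalue T)
  intro k l hkl
  exact_mod_cast mul_right_cancel₀ hc hkl

/-- Left multiplication by the last nonzero power of e kills every term that starts with e without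
losing the others. -/
theorem exists_pow_ne_zero_of_lie_eq_smul {e h : Matrix n n ℂ} {c : ℂ} (hne : e ≠ 0) (hc : c ≠ 0)
    (he : h * e - e * h = c • e) : ∃ k, e ^ k ≠ 0 ∧ e ^ (k + 1) = 0 := by
  have hnil := exists_pow_eq_zero_of_lie_eq_smul hc he
  obtain ⟨k, hk⟩ : ∃ k, Nat.find hnil = k + 1 := by
    refine Nat.exists_eq_succ_of_ne_zero fun h0 => hne ?_
    have := Nat.find_spec hnil
    rw [h0, pow_zero] at this
    rw [← one_mul e, this, zero_mul]
  exact ⟨k, Nat.find_min hnil (by omega), hk ▸ Nat.find_spec hnil⟩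

variable (g : LieSubalgebra ℂ (Matrix n n ℂ)) (π : Matrix n n ℂ →ₗ[ℂ] g) (hπ : ∀ x : g, π x = x)

include hπ in
-- Cyclicity of the trace along the inclusion of g and the projection π moves the computation to the
-- full matrix space.
theorem trace_end_eq_sum (T : g →ₗ[ℂ] g) :
    LinearMap.trace ℂ g T = ∑ i, ∑ j, (T (π (single i j 1)) : Matrix n n ℂ) i j := by
  have h : T = (T ∘ₗ π) ∘ₗ g.toSubmodule.subtype := by
    refine LinearMap.ext fun x => ?_
    change T x = T (π (x : Matrix n n ℂ))
    rw [hπ]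
  conv_lhs => rw [h, LinearMap.trace_comp_comm', trace_end_matrix]
  refine Finset.sum_congr rfl fun i _ => Finset.sum_congr rfl fun j _ => ?_
  rfl

theorem isKilling_of_killingForm_eq {κ : ℂ} (hκ : κ ≠ 0)
    (hk : ∀ x y : g, killingForm ℂ g x y = κ * ((x : Matrix n n ℂ) * y).trace)
    (hg : ∀ x : g, (∀ y : g, ((x : Matrix n n ℂ) * y).trace = 0) → x = 0) : IsKilling ℂ g := by
  refine ⟨(LieSubmodule.eq_bot_iff _).2 fun x hx => hg x fun y => ?_⟩
  have := (LieIdeal.mem_killingCompl ℂ g ⊤).1 hx y (LieSubmodule.mem_top y)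
  rw [hk, mul_eq_zero] at this
  rw [Matrix.trace_mul_comm]
  exact this.resolve_left hκ

end Matrices

end JosephIdeal

namespace JosephIdeal

open Module LieAlgebra Matrix

/-! ### The special linear algebra. -/

section SpecialLinear

attribute [local instance 100] LieRing.ofAssociativeRing

variable {n : Type*} [Fintype n] [DecidableEq n]

theorem mem_sl_iff {M : Matrix n n ℂ} : M ∈ SpecialLinear.sl n ℂ ↔ M.trace = 0 := Iff.rfl

variable (n) in
/-- The projection of the matrices onto the traceless ones. -/
noncomputable def slProj [Nonempty n] : Matrix n n ℂ →ₗ[ℂ] SpecialLinear.sl n ℂ :=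
  (LinearMap.id - (LinearMap.toSpanSingleton ℂ (Matrix n n ℂ) 1) ∘ₗ
    ((Fintype.card n : ℂ)⁻¹ • Matrix.traceLinearMap n ℂ ℂ)).codRestrict
    (SpecialLinear.sl n ℂ).toSubmodule fun M => by
      change Matrix.trace _ = 0
      have : (Fintype.card n : ℂ) ≠ 0 := by simp
      simp only [LinearMap.sub_apply, LinearMap.id_apply, LinearMap.comp_apply,
        LinearMap.smul_apply, LinearMap.toSpanSingleton_apply, Matrix.traceLinearMap_apply,
        Matrix.trace_sub, Matrix.trace_smul, Matrix.trace_one, smul_eq_mul]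
      field_simp
      ring

variable [Nonempty n]

theorem coe_slProj (M : Matrix n n ℂ) :
    (slProj n M : Matrix n n ℂ) = M - ((Fintype.card n : ℂ)⁻¹ * M.trace) • 1 := rfl

theorem slProj_coe (x : SpecialLinear.sl n ℂ) : slProj n x = x := by
  apply Subtype.ext
  rw [coe_slProj, mem_sl_iff.1 x.2]
  simp

theorem killingForm_sl (x y : SpecialLinear.sl n ℂ) : killingForm ℂ _ x y
    = (2 * Fintype.card n) * ((x : Matrix n n ℂ) * y).trace := by
  rw [killingForm_apply_apply, trace_end_eq_sum _ _ slProj_coe]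
  obtain ⟨X, hX⟩ := x
  obtain ⟨Y, hY⟩ := y
  rw [mem_sl_iff] at hX hY
  -- The scalar matrix subtracted by `slProj` is central and drops out of the brackets.
  have h : ∀ i j : n, (((ad ℂ _ ⟨X, hX⟩ ∘ₗ ad ℂ (SpecialLinear.sl n ℂ) ⟨Y, hY⟩)
        (slProj n (single i j 1)) : SpecialLinear.sl n ℂ) : Matrix n n ℂ)
      = X * Y * single i j 1 * 1 - X * single i j 1 * Y - Y * single i j 1 * X
        + 1 * single i j 1 * (Y * X) := by
    intro i j
    simp only [LinearMap.comp_apply, ad_apply, LieSubalgebra.coe_bracket, coe_slProj,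
      Ring.lie_def]
    simp only [mul_sub, sub_mul, mul_smul_comm, smul_mul_assoc, mul_one, one_mul, mul_assoc]
    abel
  simp only [h, Matrix.add_apply, Matrix.sub_apply, Finset.sum_add_distrib,
    Finset.sum_sub_distrib, sum_mul_single_mul_apply]
  rw [hX, hY, Matrix.trace_mul_comm Y X, Matrix.trace_one]
  ring

theorem finrank_sl : (finrank ℂ (SpecialLinear.sl n ℂ) : ℂ) = (Fintype.card n : ℂ) ^ 2 - 1 := by
  rw [← LinearMap.trace_id, trace_end_eq_sum _ _ slProj_coe]
  have h : ∀ i j : n, (slProj n (single i j 1) : Matrix n n ℂ) i j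
      = (1 * single i j 1 * 1 : Matrix n n ℂ) i j
        - (Fintype.card n : ℂ)⁻¹ * (1 * single j i 1 * 1 : Matrix n n ℂ) i j := by
    intro i j
    rw [coe_slProj]
    by_cases hij : i = j
    · subst hij; simp
    · simp [hij, Matrix.trace_single_eq_of_ne]
  have hn : (Fintype.card n : ℂ) ≠ 0 := by simp
  simp only [LinearMap.id_apply, h, Finset.sum_sub_distrib, ← Finset.mul_sum,
    sum_mul_single_mul_apply, sum_mul_single_swap_mul_apply]
  simp only [Matrix.transpose_one, mul_one, Matrix.trace_one]
  field_simp

theorem isKilling_sl : IsKilling ℂ (SpecialLinear.sl n ℂ) := by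
  refine isKilling_of_killingForm_eq _ (κ := 2 * Fintype.card n) (by simp) killingForm_sl
    fun x hx => Subtype.ext (eq_zero_of_forall_trace_mul fun A => ?_)
  have := hx (slProj n A)
  rw [coe_slProj, mul_sub, Matrix.trace_sub, mul_smul_comm, Matrix.trace_smul, mul_one,
    mem_sl_iff.1 x.2, smul_zero, sub_zero] at this
  exact this

/-- Extremal elements of `sl n` are the traceless matrices of rank one. -/
theorem eq_of_isExtremal_sl {e : SpecialLinear.sl n ℂ} {s : ℂ} (he : IsExtremal e s) :
    s = (Fintype.card n : ℂ)⁻¹ := by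
  obtain ⟨hne, ⟨⟨h, hh⟩, c, hc, hlie⟩, hext⟩ := he
  obtain ⟨e, htr⟩ := e
  replace hne : e ≠ 0 := fun h => hne (Subtype.ext h)
  rw [mem_sl_iff] at htr
  have hlie : h * e - e * h = c • e := congrArg Subtype.val hlie
  set σ : ℂ := s * (2 * Fintype.card n) with hσ
  set N := e * e with hN
  have hM : ∀ M, N * M + M * N - (2 : ℂ) • (e * M * e) = -(σ * (e * M).trace) • e := by
    intro M
    have := congrArg Subtype.val (hext (slProj n M))
    rw [killingForm_sl] at this
    simp only [LieSubalgebra.coe_bracket, coe_slProj, Ring.lie_def, mul_sub, sub_mul,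
      mul_smul_comm, smul_mul_assoc, mul_one, one_mul, Matrix.trace_sub, Matrix.trace_smul, htr,
      smul_zero, sub_zero, SetLike.val_smul, mul_assoc] at this
    rw [hσ, hN, two_smul]
    simp only [mul_assoc]
    rw [← this]
    abel
  -- The contraction of `hM` at M = A Eⱼᵢ.
  have hA : ∀ A, ((N * A).trace) • (1 : Matrix n n ℂ) + A.trace • N
      - (2 * (e * A).trace) • e = -σ • (e * A * e) := by
    intro A
    have h1 := sum_single_mul_single (N * A) 1
    have h2 := sum_single_mul_single A N
    have h3 := sum_single_mul_single (e * A) e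
    have h4 := sum_trace_smul_single_mul (e * A) e
    rw [← h1, ← h2, mul_smul, ← h3, ← h4]
    simp only [Finset.smul_sum, ← Finset.sum_add_distrib, ← Finset.sum_sub_distrib]
    refine Finset.sum_congr rfl fun i _ => Finset.sum_congr rfl fun j _ => ?_
    have := congrArg (single i j 1 * ·) (hM (A * single j i 1))
    simp only [mul_add, mul_sub, mul_smul_comm] at this
    simp only [mul_one, mul_assoc, mul_smul_comm, smul_smul, neg_mul] at this ⊢
    exact this
  -- After left multiplication by the last nonzero power eᵏ only tr(NA) eᵏ remains, so tr(NA) = 0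
  -- for all A.
  have hN0 : N = 0 := by
    obtain ⟨k, hk0, hk1⟩ := exists_pow_ne_zero_of_lie_eq_smul hne hc hlie
    refine eq_zero_of_forall_trace_mul fun A => ?_
    have h1 := congrArg (e ^ k * ·) (hA A)
    have h2 : e ^ k * e = 0 := by rw [← pow_succ, hk1]
    simp only [mul_add, mul_sub, mul_smul_comm, hN, ← mul_assoc, h2, zero_mul, smul_zero,
      mul_one, add_zero, sub_zero] at h1
    exact (smul_eq_zero.1 h1).resolve_right hk0
  obtain ⟨i, j, hij⟩ : ∃ i j, e i j ≠ 0 := by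
    by_contra! h0; exact hne (Matrix.ext h0)
  -- With N = 0, the choice A = Eⱼᵢ compares multiples of eᵢⱼ² and gives σ = 2, that is s = 1/n.
  have h1 := congrFun (congrFun (hA (single j i 1)) i) j
  simp only [hN0, zero_mul, Matrix.trace_zero, zero_smul, smul_zero, zero_add, zero_sub,
    Matrix.neg_apply, Matrix.smul_apply, smul_eq_mul] at h1
  have h2 : (e * single j i 1).trace = e i j := by
    simp [Matrix.trace, Matrix.mul_apply, Matrix.single_apply, ite_and]
  have h3 : (e * single j i 1 * e : Matrix n n ℂ) i j = e i j * e i j := by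
    simp [Matrix.mul_apply, Matrix.single_apply, ite_and]
  rw [h2, h3] at h1
  have h4 : σ = 2 := by
    have : (e i j * e i j) * (σ - 2) = 0 := by linear_combination h1
    exact sub_eq_zero.1 ((mul_eq_zero.1 this).resolve_left (mul_ne_zero hij hij))
  have hn : (Fintype.card n : ℂ) ≠ 0 := by simp
  rw [hσ] at h4
  field_simp
  linear_combination h4 / 2

end SpecialLinear

end JosephIdeal

namespace JosephIdeal

open Module LieAlgebra Matrix

/-! ### Orthogonal (ε = 1) and symplectic (ε = -1) algebras together. -/

section SkewAdjoint

attribute [local instance 100] LieRing.ofAssociativeRing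

variable {n : Type*} [Fintype n] [DecidableEq n] {J : Matrix n n ℂ} {ε : ℂ}

/-- The adjoint `M ↦ J⁻¹ Mᵀ J` for a form `J` with `J² = ε = ±1`. -/
noncomputable def formAdjoint (J : Matrix n n ℂ) (ε : ℂ) : Matrix n n ℂ →ₗ[ℂ] Matrix n n ℂ where
  toFun M := ε • (J * Mᵀ * J)
  map_add' A B := by simp [mul_add, add_mul]
  map_smul' r A := by simp [smul_comm r ε]

theorem formAdjoint_apply (M : Matrix n n ℂ) : formAdjoint J ε M = ε • (J * Mᵀ * J) := rfl

variable (hε : ε * ε = 1) (hJ : J * J = ε • 1) (hJt : Jᵀ = ε • J)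

include hε hJ in
theorem mul_formAdjoint (M : Matrix n n ℂ) : J * formAdjoint J ε M = Mᵀ * J := by
  rw [formAdjoint_apply, mul_smul_comm, mul_assoc, ← mul_assoc, hJ, smul_mul_assoc, one_mul,
    smul_smul, hε, one_smul]

include hε hJ in
theorem formAdjoint_mul (A B : Matrix n n ℂ) :
    formAdjoint J ε (A * B) = formAdjoint J ε B * formAdjoint J ε A := by
  rw [formAdjoint_apply, formAdjoint_apply B, smul_mul_assoc, mul_assoc (J * Bᵀ),
    mul_formAdjoint hε hJ, Matrix.transpose_mul]
  simp only [mul_assoc]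

include hε hJ hJt in
theorem formAdjoint_formAdjoint (A : Matrix n n ℂ) :
    formAdjoint J ε (formAdjoint J ε A) = A := by
  simp only [formAdjoint_apply, Matrix.transpose_smul, Matrix.transpose_mul, hJt,
    Matrix.transpose_transpose, mul_smul_comm, smul_mul_assoc, smul_smul]
  have h : J * (J * (A * J)) * J = (J * J) * A * (J * J) := by noncomm_ring
  rw [h, hJ]
  simp [smul_smul, hε]

include hε hJ in
theorem trace_formAdjoint (A : Matrix n n ℂ) : (formAdjoint J ε A).trace = A.trace := by
  rw [formAdjoint_apply, Matrix.trace_smul, Matrix.trace_mul_cycle, hJ]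
  simp [← mul_assoc, hε]

include hε hJ in
theorem mem_skewAdjoint_iff (M : Matrix n n ℂ) :
    M ∈ skewAdjointMatricesLieSubalgebra J ↔ formAdjoint J ε M = -M := by
  rw [mem_skewAdjointMatricesLieSubalgebra, mem_skewAdjointMatricesSubmodule]
  change Mᵀ * J = J * -M ↔ _
  rw [← mul_formAdjoint hε hJ]
  refine ⟨fun h => ?_, fun h => by rw [h]⟩
  have := congrArg (ε • (J * ·)) h
  simpa [← mul_assoc, hJ, smul_smul, hε] using this

/-- The projection of the matrices onto the skew-adjoint ones. -/
noncomputable def skewProj :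
    Matrix n n ℂ →ₗ[ℂ] skewAdjointMatricesLieSubalgebra J :=
  ((1 / 2 : ℂ) • (LinearMap.id - formAdjoint J ε)).codRestrict
    (skewAdjointMatricesLieSubalgebra J).toSubmodule fun M => by
      refine (mem_skewAdjoint_iff hε hJ _).2 ?_
      simp only [LinearMap.smul_apply, LinearMap.sub_apply, LinearMap.id_apply, map_smul, map_sub,
        formAdjoint_formAdjoint hε hJ hJt]
      module

theorem coe_skewProj (M : Matrix n n ℂ) : (skewProj hε hJ hJt M : Matrix n n ℂ)
    = (1 / 2 : ℂ) • (M - formAdjoint J ε M) := rfl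

theorem skewProj_coe (x : skewAdjointMatricesLieSubalgebra J) : skewProj hε hJ hJt x = x := by
  apply Subtype.ext
  rw [coe_skewProj, (mem_skewAdjoint_iff hε hJ _).1 x.2]
  module

include hε hJ hJt in
-- The projection is half of M - M*. The M part contributes n tr(XY) as for all matrices; the M*
-- part, through the swapped contraction, contributes -2ε tr(XY).
theorem killingForm_skewAdjoint (x y : skewAdjointMatricesLieSubalgebra J) : killingForm ℂ _ x y
    = (Fintype.card n - 2 * ε) * ((x : Matrix n n ℂ) * y).trace := by
  rw [killingForm_apply_apply, trace_end_eq_sum _ _ (skewProj_coe hε hJ hJt)]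
  obtain ⟨X, hX⟩ := x
  obtain ⟨Y, hY⟩ := y
  have h : ∀ i j : n, (((ad ℂ _ ⟨X, hX⟩ ∘ₗ ad ℂ (skewAdjointMatricesLieSubalgebra J) ⟨Y, hY⟩)
        (skewProj hε hJ hJt (single i j 1)) : skewAdjointMatricesLieSubalgebra J) : Matrix n n ℂ)
      = (1 / 2 : ℂ) • ((X * Y * single i j 1 * 1 - X * single i j 1 * Y - Y * single i j 1 * X
        + 1 * single i j 1 * (Y * X))
        - ε • ((X * Y * J) * single j i 1 * J - (X * J) * single j i 1 * (J * Y)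
        - (Y * J) * single j i 1 * (J * X) + J * single j i 1 * (J * Y * X))) := by
    intro i j
    simp only [LinearMap.comp_apply, ad_apply, LieSubalgebra.coe_bracket, coe_skewProj,
      Ring.lie_def, formAdjoint_apply, Matrix.transpose_single]
    simp only [mul_sub, sub_mul, mul_smul_comm, smul_mul_assoc, mul_one, one_mul, mul_assoc]
    module
  simp only [h, Matrix.add_apply, Matrix.sub_apply, Matrix.smul_apply, smul_eq_mul,
    ← Finset.mul_sum, Finset.sum_add_distrib,
    Finset.sum_sub_distrib, sum_mul_single_mul_apply, sum_mul_single_swap_mul_apply]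
  have hX' := (mem_skewAdjoint_iff hε hJ _).1 hX
  have hY' := (mem_skewAdjoint_iff hε hJ _).1 hY
  have hXt : X.trace = 0 := by
    have := congrArg Matrix.trace hX'
    rw [trace_formAdjoint hε hJ, Matrix.trace_neg] at this
    linear_combination this / 2
  have hYt : Y.trace = 0 := by
    have := congrArg Matrix.trace hY'
    rw [trace_formAdjoint hε hJ, Matrix.trace_neg] at this
    linear_combination this / 2
  have hεJ : ∀ A : Matrix n n ℂ, J * Aᵀ * J = ε • formAdjoint J ε A := fun A => by
    rw [formAdjoint_apply, smul_smul, hε, one_smul]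
  have t1 : (X * Y * J * Jᵀ).trace = (X * Y).trace := by
    rw [hJt, mul_smul_comm, mul_assoc, hJ, mul_smul_comm, smul_smul, hε, one_smul, mul_one]
  have t2 : ∀ A B : Matrix n n ℂ, formAdjoint J ε B = -B →
      (A * J * (J * B)ᵀ).trace = - (A * B).trace := by
    intro A B hB
    rw [Matrix.transpose_mul, hJt, mul_smul_comm, mul_smul_comm, mul_assoc, ← mul_assoc J, hεJ, hB,
      mul_smul_comm, smul_smul, hε, one_smul, mul_neg, Matrix.trace_neg]
  have t3 : (J * (J * Y * X)ᵀ).trace = (X * Y).trace := by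
    rw [mul_assoc, Matrix.transpose_mul, hJt, mul_smul_comm, mul_smul_comm, ← mul_assoc, hεJ,
      smul_smul, hε, one_smul, trace_formAdjoint hε hJ, Matrix.trace_mul_comm]
  rw [t1, t2 _ _ hY', t2 _ _ hX', t3, hXt, hYt, Matrix.trace_mul_comm Y X, Matrix.trace_one]
  ring

include hε hJ hJt in
theorem finrank_skewAdjoint : (finrank ℂ (skewAdjointMatricesLieSubalgebra J) : ℂ)
    = (Fintype.card n : ℂ) * (Fintype.card n - ε) / 2 := by
  rw [← LinearMap.trace_id, trace_end_eq_sum _ _ (skewProj_coe hε hJ hJt)]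
  have h : ∀ i j : n, (skewProj hε hJ hJt (single i j 1) : Matrix n n ℂ)
      = (1 / 2 : ℂ) • (1 * single i j 1 * 1 - ε • (J * single j i 1 * J)) := by
    intro i j
    rw [coe_skewProj, formAdjoint_apply, Matrix.transpose_single, one_mul, mul_one]
  simp only [LinearMap.id_apply, h, Matrix.sub_apply, Matrix.smul_apply, smul_eq_mul,
    ← Finset.mul_sum, Finset.sum_sub_distrib, sum_mul_single_mul_apply,
    sum_mul_single_swap_mul_apply]
  rw [hJt, mul_smul_comm, hJ, smul_smul, hε, one_smul, Matrix.trace_one]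
  ring

include hε hJ hJt in
theorem isKilling_skewAdjoint (hn : (Fintype.card n : ℂ) - 2 * ε ≠ 0) :
    IsKilling ℂ (skewAdjointMatricesLieSubalgebra J) := by
  refine isKilling_of_killingForm_eq _ hn (killingForm_skewAdjoint hε hJ hJt)
    fun x hx => Subtype.ext (eq_zero_of_forall_trace_mul fun A => ?_)
  have h := hx (skewProj hε hJ hJt A)
  have h2 : ((x : Matrix n n ℂ) * formAdjoint J ε A).trace = -((x : Matrix n n ℂ) * A).trace := by
    rw [← trace_formAdjoint hε hJ, formAdjoint_mul hε hJ, formAdjoint_formAdjoint hε hJ hJt,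
      (mem_skewAdjoint_iff hε hJ _).1 x.2, mul_neg, Matrix.trace_neg, Matrix.trace_mul_comm]
  rw [coe_skewProj, mul_smul_comm, Matrix.trace_smul, mul_sub, Matrix.trace_sub, h2,
    smul_eq_mul] at h
  linear_combination h

include hε hJ hJt in
/-- The contraction of the extremality relation for a skew-adjoint matrix. -/
theorem contraction_of_isExtremal {e : skewAdjointMatricesLieSubalgebra J} {s : ℂ}
    (he : IsExtremal e s) (A : Matrix n n ℂ) :
    ((e : Matrix n n ℂ) * e * A).trace • (1 : Matrix n n ℂ) + A.trace • ((e : Matrix n n ℂ) * e)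
      - (2 * ((e : Matrix n n ℂ) * A).trace) • (e : Matrix n n ℂ)
      - ε • (e * e * formAdjoint J ε A + formAdjoint J ε A * (e * e))
      - (2 * ε) • (e * formAdjoint J ε A * e)
      = -(2 * (s * (Fintype.card n - 2 * ε))) • (e * A * e) := by
  have hext := he.lie_lie
  obtain ⟨e, hme⟩ := e
  have hes := (mem_skewAdjoint_iff hε hJ _).1 hme
  simp only
  clear he
  set σ : ℂ := s * (Fintype.card n - 2 * ε) with hσ
  set N := e * e with hN
  have hNs : formAdjoint J ε N = N := by
    rw [hN, formAdjoint_mul hε hJ, hes, neg_mul_neg]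
  -- Extremality tested on the skew part of M, doubled to clear the factor 1/2.
  have hM : ∀ M, N * M + M * N - (2 : ℂ) • (e * M * e) - (N * formAdjoint J ε M
      + formAdjoint J ε M * N - (2 : ℂ) • (e * formAdjoint J ε M * e))
      = -(2 * σ * (e * M).trace) • e := by
    intro M
    have htr : (e * formAdjoint J ε M).trace = -(e * M).trace := by
      rw [← trace_formAdjoint hε hJ, formAdjoint_mul hε hJ, formAdjoint_formAdjoint hε hJ hJt,
        hes, mul_neg, Matrix.trace_neg, Matrix.trace_mul_comm]
    have := congrArg Subtype.val (hext (skewProj hε hJ hJt M))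
    rw [killingForm_skewAdjoint hε hJ hJt] at this
    simp only [LieSubalgebra.coe_bracket, coe_skewProj, Ring.lie_def, mul_sub, sub_mul,
      mul_smul_comm, smul_mul_assoc, Matrix.trace_sub, Matrix.trace_smul, htr,
      SetLike.val_smul, mul_assoc, smul_eq_mul] at this
    have h2 := congrArg ((2 : ℂ) • ·) this
    rw [hσ, hN]
    simp only [mul_assoc]
    refine Eq.trans ?_ (h2.trans ?_) <;> module
  -- Contraction of the terms in M*: the adjoint turns Eⱼᵢ into Eᵢⱼ up to J, so the transposed rule
  -- applies.
  have hX : ∀ X Y, ∑ i, ∑ j, single i j 1 * (X * formAdjoint J ε (A * single j i 1) * Y)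
      = ε • (formAdjoint J ε X * formAdjoint J ε A * Y) := by
    intro X Y
    have h := sum_single_mul_single_swap (X * J) (Aᵀ * J * Y)
    rw [← formAdjoint_mul hε hJ]
    simp only [formAdjoint_apply, Matrix.transpose_mul, Matrix.transpose_single, hJt,
      smul_mul_assoc, mul_smul_comm, ← Finset.smul_sum, mul_assoc] at h ⊢
    rw [h]
  have hf1 : formAdjoint J ε 1 = 1 := by
    rw [formAdjoint_apply, Matrix.transpose_one, mul_one, hJ, smul_smul, hε, one_smul]
  have h1 := sum_single_mul_single (N * A) 1
  have h2 := sum_single_mul_single A N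
  have h3 := sum_single_mul_single (e * A) e
  have h4 := sum_trace_smul_single_mul (e * A) e
  have h5 := hX N 1
  have h6 := hX 1 N
  have h7 := hX e e
  rw [hNs, mul_one] at h5
  rw [hf1, one_mul] at h6
  rw [hes, neg_mul, neg_mul, smul_neg] at h7
  have h8 : (2 * ε) • (e * formAdjoint J ε A * e)
      = -((2 : ℂ) • -(ε • (e * formAdjoint J ε A * e))) := by module
  rw [smul_add, h8, ← h1, ← h2, mul_smul, ← h3, ← h4, ← h5, ← h6, ← h7]
  simp only [Finset.smul_sum, ← Finset.sum_add_distrib, ← Finset.sum_sub_distrib,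
    ← Finset.sum_neg_distrib]
  refine Finset.sum_congr rfl fun i _ => Finset.sum_congr rfl fun j _ => ?_
  have := congrArg (single i j 1 * ·) (hM (A * single j i 1))
  simp only [mul_add, mul_sub, mul_smul_comm] at this
  simp only [mul_one, one_mul, mul_assoc, mul_smul_comm, smul_smul, neg_mul] at this ⊢
  rw [← this]
  module

include hε hJ hJt in
-- If N = e² were nonzero, multiplying the contracted identity by powers of e would give e³ = 0,
-- then 2σε = 1, and A = 1 would give n - 4ε + 2σ = 0. Together these say n = 3ε, the excluded case.
theorem mul_self_eq_zero_of_isExtremal (hn : (Fintype.card n : ℂ) ≠ 3 * ε)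
    {e : skewAdjointMatricesLieSubalgebra J} {s : ℂ} (he : IsExtremal e s) :
    (e : Matrix n n ℂ) * e = 0 := by
  have hA := contraction_of_isExtremal hε hJ hJt he
  obtain ⟨hne, ⟨⟨h, hh⟩, c, hc, hlie⟩, -⟩ := he
  obtain ⟨e, hme⟩ := e
  have hes := (mem_skewAdjoint_iff hε hJ _).1 hme
  replace hne : e ≠ 0 := fun h => hne (Subtype.ext h)
  have hlie : h * e - e * h = c • e := congrArg Subtype.val hlie
  simp only at hA ⊢
  set σ : ℂ := s * (Fintype.card n - 2 * ε)
  have hNs : formAdjoint J ε (e * e) = e * e := by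
    rw [formAdjoint_mul hε hJ, hes, neg_mul_neg]
  have hε0 : ε ≠ 0 := by rintro rfl; simp at hε
  obtain ⟨k, hk0, hk1⟩ := exists_pow_ne_zero_of_lie_eq_smul hne hc hlie
  by_contra hN0
  have hk2 : e ^ k * e = 0 := by rw [← pow_succ, hk1]
  have he3 : e * e * e = 0 := by
    have h : ∀ A, e ^ k * A * (e * e * e) = 0 := by
      intro A
      -- With eᵏ on the left and e on the right, only the term with A* e² survives.
      have h1 := congrArg (fun X => e ^ k * X * e) (hA (formAdjoint J ε A))
      simp only [formAdjoint_formAdjoint hε hJ hJt, mul_add, mul_sub, sub_mul,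
        mul_smul_comm, smul_mul_assoc, ← mul_assoc, hk2, zero_mul, smul_zero, mul_one, add_zero,
        sub_zero, zero_add, zero_sub, neg_eq_zero] at h1
      simpa [hε0, mul_assoc] using h1
    exact (eq_zero_or_eq_zero_of_forall_mul_mul h).resolve_left hk0
  have hNN : ∀ A, (e * e) * formAdjoint J ε A * (e * e) = (ε * (e * e * A).trace) • (e * e) := by
    intro A
    have h1 := congrArg (fun X => ε • (e * e * X)) (hA A)
    simp only [mul_add, mul_sub, mul_smul_comm, ← mul_assoc, he3, zero_mul, smul_zero, mul_one,
      add_zero, sub_zero, zero_add, smul_sub, smul_smul, hε, one_smul] at h1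
    rw [sub_eq_zero] at h1
    rw [h1, ← mul_assoc]
  have htr : ∀ A, (e * e * formAdjoint J ε A).trace = (e * e * A).trace := by
    intro A
    rw [← trace_formAdjoint hε hJ, formAdjoint_mul hε hJ, formAdjoint_formAdjoint hε hJ hJt, hNs,
      Matrix.trace_mul_comm]
  obtain ⟨A, hA0⟩ : ∃ A, (e * e * A).trace ≠ 0 := by
    by_contra! h0
    exact hN0 (eq_zero_of_forall_trace_mul h0)
  have hσ : 2 * σ * ε = 1 := by
    -- Between two factors e, every surviving term is a multiple of N by `hNN`.
    have h1 := congrArg (fun X => e * X * e) (hA A)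
    have h2 := hNN A
    have h3 := hNN (formAdjoint J ε A)
    rw [formAdjoint_formAdjoint hε hJ hJt, htr] at h3
    have he3' : ∀ X, X * e * e * e = 0 := fun X => by
      rw [mul_assoc, mul_assoc, ← mul_assoc e, he3, mul_zero]
    simp only [mul_add, mul_sub, add_mul, sub_mul, mul_smul_comm, smul_mul_assoc, ← mul_assoc,
      he3', he3, zero_mul, smul_zero, mul_one, add_zero, sub_zero] at h1 h2 h3
    rw [h2, h3, smul_smul, smul_smul, ← sub_smul, ← sub_eq_zero, ← sub_smul, smul_eq_zero] at h1
    have h4 := h1.resolve_right hN0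
    have : (e * e * A).trace * (2 * σ * ε - 1) = 0 := by
      linear_combination h4 + 2 * (e * e * A).trace * hε
    exact sub_eq_zero.1 ((mul_eq_zero.1 this).resolve_left hA0)
  have hf1 : formAdjoint J ε 1 = 1 := by
    rw [formAdjoint_apply, Matrix.transpose_one, mul_one, hJ, smul_smul, hε, one_smul]
  have he0 : e.trace = 0 := by
    have := congrArg Matrix.trace hes
    rw [trace_formAdjoint hε hJ, Matrix.trace_neg] at this
    linear_combination this / 2
  have h1 := hA 1
  simp only [hf1, mul_one, one_mul, he0, Matrix.trace_one, mul_zero, zero_smul, sub_zero] at h1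
  have htN : (e * e).trace = 0 := by
    -- Since N² = 0, multiplying by N isolates tr(N) N.
    have h2 := congrArg (fun X => e * e * X) h1
    simp only [mul_add, mul_sub, mul_smul_comm, ← mul_assoc, he3, zero_mul, smul_zero,
      mul_one, add_zero, sub_zero] at h2
    exact (smul_eq_zero.1 h2).resolve_right hN0
  rw [htN] at h1
  have h2 : ((Fintype.card n : ℂ) - 4 * ε + 2 * σ) • (e * e) = 0 := by
    rw [← sub_eq_zero] at h1
    rw [← h1]
    module
  have h3 := (smul_eq_zero.1 h2).resolve_right hN0
  apply hn
  linear_combination h3 - ε * hσ + 2 * σ * hε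

include hε hJ hJt in
/-- Skew-adjoint extremal elements satisfy a quadratic relation. -/
theorem quadratic_relation_of_isExtremal (hn : (Fintype.card n : ℂ) ≠ 3 * ε)
    {e : skewAdjointMatricesLieSubalgebra J} {s : ℂ} (he : IsExtremal e s) (A : Matrix n n ℂ) :
    ((e : Matrix n n ℂ) * A).trace • (e : Matrix n n ℂ) + ε • (e * formAdjoint J ε A * e)
      = (s * (Fintype.card n - 2 * ε)) • (e * A * e) := by
  have h := contraction_of_isExtremal hε hJ hJt he A
  rw [mul_self_eq_zero_of_isExtremal hε hJ hJt hn he, zero_mul, mul_zero, zero_mul,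
    Matrix.trace_zero] at h
  have h2 := congrArg ((-1 / 2 : ℂ) • ·) h
  refine Eq.trans ?_ (h2.trans ?_) <;> module

end SkewAdjoint

end JosephIdeal

namespace JosephIdeal

open Module LieAlgebra Matrix

/-! ### The value of s for orthogonal algebras. -/

section Orthogonal

variable {n : Type*} [Fintype n] [DecidableEq n]

/-- Extremal elements of `so n` are the bivectors of isotropic planes. -/
theorem eq_of_isExtremal_so (hn : (Fintype.card n : ℂ) ≠ 3)
    {e : skewAdjointMatricesLieSubalgebra (1 : Matrix n n ℂ)} {s : ℂ} (he : IsExtremal e s) :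
    s * (Fintype.card n - 2) = 1 := by
  have hA := quadratic_relation_of_isExtremal (J := (1 : Matrix n n ℂ)) (ε := 1) (by simp)
    (by simp) (by simp) (by simpa using hn) he
  have hne := he.ne_zero
  obtain ⟨e, hme⟩ := e
  have hes : eᵀ = -e := by
    simpa [formAdjoint_apply] using (mem_skewAdjoint_iff (ε := 1) (by simp) (by simp) e).1 hme
  replace hne : e ≠ 0 := fun h => hne (Subtype.ext h)
  obtain ⟨i, j, hij⟩ : ∃ i j, e i j ≠ 0 := by
    by_contra! h0; exact hne (Matrix.ext h0)
  have hii : e i i = 0 := by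
    have := congrFun (congrFun hes i) i
    rw [Matrix.transpose_apply, Matrix.neg_apply] at this
    linear_combination this / 2
  have h := congrFun (congrFun (hA (single j i 1)) i) j
  have h2 : (e * single j i 1).trace = e i j := by
    simp [Matrix.trace, Matrix.mul_apply, Matrix.single_apply, ite_and]
  have h3 : (e * single j i 1 * e : Matrix n n ℂ) i j = e i j * e i j := by
    simp [Matrix.mul_apply, Matrix.single_apply, ite_and]
  -- The entry is eᵢᵢ eⱼⱼ, which vanishes by skew-symmetry; the (i, j) entry of the relation then
  -- reads eᵢⱼ² = σ eᵢⱼ².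
  have h4 : (e * formAdjoint (1 : Matrix n n ℂ) 1 (single j i 1) * e : Matrix n n ℂ) i j = 0 := by
    simp [formAdjoint_apply, Matrix.mul_apply, Matrix.single_apply, ite_and, hii]
  simp only [Matrix.add_apply, Matrix.smul_apply, smul_eq_mul, h2, h3, h4] at h
  have h5 : (e i j * e i j) * (s * (Fintype.card n - 2) - 1) = 0 := by linear_combination -h
  exact sub_eq_zero.1 ((mul_eq_zero.1 h5).resolve_left (mul_ne_zero hij hij))

end Orthogonal

/-! ### The value of s for symplectic algebras. -/

section Symplectic

variable {l : Type*} [Fintype l] [DecidableEq l]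

theorem J_mul_J : Matrix.J l ℂ * Matrix.J l ℂ = (-1 : ℂ) • 1 := by
  rw [Matrix.J_squared, neg_smul, one_smul]

omit [Fintype l] in
theorem transpose_J : (Matrix.J l ℂ)ᵀ = (-1 : ℂ) • Matrix.J l ℂ := by
  rw [Matrix.J_transpose, neg_smul, one_smul]

/-- Extremal elements of `sp (2 n)` are the squares of vectors. -/
theorem eq_of_isExtremal_sp {e : skewAdjointMatricesLieSubalgebra (Matrix.J l ℂ)} {s : ℂ}
    (he : IsExtremal e s) : s * (Fintype.card (l ⊕ l) + 2) = 2 := by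
  have hA := quadratic_relation_of_isExtremal (by norm_num) J_mul_J transpose_J (by
    intro h
    have : ((Fintype.card (l ⊕ l) + 3 : ℕ) : ℂ) = 0 := by push_cast; linear_combination h
    rw [Nat.cast_eq_zero] at this
    omega) he
  have hne := he.ne_zero
  obtain ⟨e, hme⟩ := e
  have hes := (mem_skewAdjoint_iff (by norm_num) J_mul_J e).1 hme
  replace hne : e ≠ 0 := fun h => hne (Subtype.ext h)
  simp only at hA
  set J := Matrix.J l ℂ
  have hJ : J * J = -1 := Matrix.J_squared l ℂ
  have hJt : Jᵀ = -J := Matrix.J_transpose l ℂ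
  -- Passing to the symmetric matrix S removes the form J from the quadratic relation.
  set S := e * J with hS
  have hSt : Sᵀ = S := by
    have h : J * formAdjoint J (-1) e = eᵀ * J := mul_formAdjoint (by norm_num) J_mul_J e
    rw [hes] at h
    rw [hS, Matrix.transpose_mul, hJt]
    have h2 := congrArg (J * · * J) h
    simp only [mul_neg, neg_mul, ← mul_assoc, hJ, one_mul, neg_neg] at h2
    rw [h2, mul_assoc, hJ]
    simp
  have hrel : ∀ B, (S * B).trace • S + S * Bᵀ * S
      = (s * (Fintype.card (l ⊕ l) + 2)) • (S * B * S) := by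
    intro B
    have h := congrArg (· * J) (hA (J * B))
    have h2 : formAdjoint J (-1) (J * B) = -(J * Bᵀ) := by
      rw [formAdjoint_apply, Matrix.transpose_mul, hJt, ← mul_assoc, mul_neg, neg_mul, mul_assoc,
        hJ]
      simp
    rw [h2] at h
    simp only [add_mul, smul_mul_assoc, mul_neg, neg_mul, ← mul_assoc, neg_smul, one_smul,
      neg_neg, mul_one, sub_neg_eq_add] at h
    rw [hS]
    simp only [← mul_assoc]
    exact h
  have hs2 : ∀ i j, S j i = S i j := fun i j => congrFun (congrFun hSt i) j
  have htr : ∀ i j, (S * single j i 1).trace = S i j := by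
    intro i j
    simp [Matrix.trace, Matrix.mul_apply, Matrix.single_apply, ite_and]
  have hent : ∀ i j k m, (S * single j i 1 * S : Matrix _ _ ℂ) k m = S k j * S i m := by
    intro i j k m
    simp [Matrix.mul_apply, Matrix.single_apply, ite_and]
  have hrel' : ∀ i j k m, S i j * S k m + S k i * S j m
      = (s * (Fintype.card (l ⊕ l) + 2)) * (S k j * S i m) := by
    intro i j k m
    have h := congrFun (congrFun (hrel (single j i 1)) k) m
    simpa only [Matrix.add_apply, Matrix.smul_apply, smul_eq_mul, htr, hent,
      Matrix.transpose_single] using h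
  obtain ⟨i, j, hij⟩ : ∃ i j, S i j ≠ 0 := by
    by_contra! h0
    have hS0 : S = 0 := Matrix.ext h0
    refine hne ?_
    have : e * J * J = 0 := by rw [← hS, hS0, zero_mul]
    rw [mul_assoc, hJ] at this
    simpa using this
  -- A nonzero entry Sᵢⱼ forces Sᵢᵢ ≠ 0, since otherwise 2Sᵢⱼ² = 0; the diagonal relation 2Sᵢᵢ² =
  -- σSᵢᵢ² can then be divided.
  have hii : S i i ≠ 0 := by
    intro h0
    have h := hrel' i j j i
    rw [h0, hs2 i j] at h
    have h3 : S i j * S i j = 0 := by linear_combination h / 2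
    exact hij (mul_self_eq_zero.1 h3)
  have h := hrel' i i i i
  have h5 : (S i i * S i i) * (s * (Fintype.card (l ⊕ l) + 2) - 2) = 0 := by linear_combination -h
  exact sub_eq_zero.1 ((mul_eq_zero.1 h5).resolve_left (mul_ne_zero hii hii))

end Symplectic

end JosephIdeal

/-! ### Numerical specialisation to the three classical families. -/

namespace JosephIdeal

open Module LieAlgebra Matrix

attribute [local instance 100] LieRing.ofAssociativeRing

theorem nontrivial_of_finrank_cast_ne_zero {V : Type*} [AddCommGroup V] [Module ℂ V]
    (h : (finrank ℂ V : ℂ) ≠ 0) : Nontrivial V :=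
  nontrivial_of_finrank_pos (R := ℂ) (Nat.pos_of_ne_zero fun h0 => h (by rw [h0]; simp))

theorem isTrivialQuotient_so {n : ℕ} {c : ℂ} (hn : 5 ≤ n)
    (hc : c ≠ -(((n : ℂ) - 4) / (4 * ((n : ℂ) - 1) * ((n : ℂ) - 2)))) :
    IsTrivialQuotient (Orthogonal.so (Fin n) ℂ) c := by
  -- In terms of k the factors n - 1, n - 2 and n - 3 are positive integers, hence visibly nonzero.
  obtain ⟨k, rfl⟩ := Nat.exists_eq_add_of_le' hn
  have hk : ∀ m : ℕ, ((k + (m + 1) : ℕ) : ℂ) ≠ 0 := fun m =>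
    Nat.cast_ne_zero.2 (Nat.succ_ne_zero _)
  have h2 : (k : ℂ) + 2 ≠ 0 := by simpa using hk 1
  have h3 : (k : ℂ) + 3 ≠ 0 := by simpa using hk 2
  have h4 : (k : ℂ) + 4 ≠ 0 := by simpa using hk 3
  have h5 : (k : ℂ) + 5 ≠ 0 := by simpa using hk 4
  have hκ : (Fintype.card (Fin (k + 5)) : ℂ) - 2 * 1 ≠ 0 := by
    rw [Fintype.card_fin]; push_cast; convert h3 using 1; ring
  have hdim : (finrank ℂ (Orthogonal.so (Fin (k + 5)) ℂ) : ℂ) = (k + 5) * (k + 4) / 2 := by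
    refine (finrank_skewAdjoint (J := (1 : Matrix _ _ ℂ)) (ε := 1) (by simp)
      (by simp) (by simp)).trans ?_
    rw [Fintype.card_fin]; push_cast; ring
  have : Nontrivial (Orthogonal.so (Fin (k + 5)) ℂ) :=
    nontrivial_of_finrank_cast_ne_zero (by rw [hdim]; simp [h5, h4])
  have : IsKilling ℂ (Orthogonal.so (Fin (k + 5)) ℂ) :=
    isKilling_skewAdjoint (J := (1 : Matrix _ _ ℂ)) (ε := 1) (by simp) (by simp) (by simp) hκ
  refine isTrivialQuotient_of_forall_isExtremal (s := 1 / ((k : ℂ) + 3)) (fun e r he => ?_) ?_ ?_ ?_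
  · have h := eq_of_isExtremal_so (by
      rw [Fintype.card_fin]; push_cast; intro h; exact h2 (by linear_combination h)) he
    rw [Fintype.card_fin] at h
    push_cast at h
    rw [eq_div_iff h3]
    linear_combination h
  · have : 2 + 2 * (1 / ((k : ℂ) + 3)) = 2 * (k + 4) / (k + 3) := by field_simp; ring
    rw [this]
    exact div_ne_zero (mul_ne_zero two_ne_zero h4) h3
  · have : 1 + 2 * (1 / ((k : ℂ) + 3)) = (k + 5) / (k + 3) := by field_simp; ring
    rw [this]
    exact div_ne_zero h5 h3
  · have e1 : ((k + 5 : ℕ) : ℂ) - 4 = k + 1 := by push_cast; ring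
    have e2 : ((k + 5 : ℕ) : ℂ) - 1 = k + 4 := by push_cast; ring
    have e3 : ((k + 5 : ℕ) : ℂ) - 2 = k + 3 := by push_cast; ring
    rw [e1, e2, e3] at hc
    -- The scalar is (n - 1)/2 times the distance of c from the exceptional value.
    have : c * (1 / ((k : ℂ) + 3) * ((k + 5) * (k + 4) / 2) - 1 - 1 / (k + 3))
        - (2 * (1 / ((k : ℂ) + 3)) - 1) / 8
        = (k + 4) / 2 * (c - -((k + 1) / (4 * (k + 4) * (k + 3)))) := by
      field_simp
      ring
    rw [hdim, this]
    exact mul_ne_zero (div_ne_zero h4 two_ne_zero) (sub_ne_zero.2 hc)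

theorem isTrivialQuotient_sp {n : ℕ} {c : ℂ} (hn : 2 ≤ n)
    (hc : c ≠ -(1 / (16 * ((n : ℂ) + 1)))) :
    IsTrivialQuotient (Symplectic.sp (Fin n) ℂ) c := by
  obtain ⟨k, rfl⟩ := Nat.exists_eq_add_of_le' hn
  have hk : ∀ m : ℕ, ((k + (m + 1) : ℕ) : ℂ) ≠ 0 := fun m =>
    Nat.cast_ne_zero.2 (Nat.succ_ne_zero _)
  have h1 : (k : ℂ) + 1 ≠ 0 := by simpa using hk 0
  have h2 : (k : ℂ) + 2 ≠ 0 := by simpa using hk 1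
  have h3 : (k : ℂ) + 3 ≠ 0 := by simpa using hk 2
  have h4 : (k : ℂ) + 4 ≠ 0 := by simpa using hk 3
  have h5 : (k : ℂ) + 5 ≠ 0 := by simpa using hk 4
  have h6 : 2 * (k : ℂ) + 5 ≠ 0 := by
    have : ((2 * k + 5 : ℕ) : ℂ) ≠ 0 := Nat.cast_ne_zero.2 (Nat.succ_ne_zero _)
    simpa using this
  have hcard : (Fintype.card (Fin (k + 2) ⊕ Fin (k + 2)) : ℂ) = 2 * (k + 2) := by
    rw [Fintype.card_sum, Fintype.card_fin]; push_cast; ring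
  have hκ : (Fintype.card (Fin (k + 2) ⊕ Fin (k + 2)) : ℂ) - 2 * (-1) ≠ 0 := by
    rw [hcard]
    convert mul_ne_zero two_ne_zero h3 using 1
    ring
  have hdim : (finrank ℂ (Symplectic.sp (Fin (k + 2)) ℂ) : ℂ) = (k + 2) * (2 * k + 5) := by
    refine (finrank_skewAdjoint (by norm_num) J_mul_J transpose_J).trans ?_
    rw [hcard]; ring
  have : Nontrivial (Symplectic.sp (Fin (k + 2)) ℂ) :=
    nontrivial_of_finrank_cast_ne_zero (by rw [hdim]; exact mul_ne_zero h2 h6)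
  have : IsKilling ℂ (Symplectic.sp (Fin (k + 2)) ℂ) :=
    isKilling_skewAdjoint (by norm_num) J_mul_J transpose_J hκ
  refine isTrivialQuotient_of_forall_isExtremal (s := 1 / ((k : ℂ) + 3)) (fun e r he => ?_) ?_ ?_ ?_
  · have h := eq_of_isExtremal_sp he
    rw [hcard] at h
    rw [eq_div_iff h3]
    linear_combination h / 2
  · have : 2 + 2 * (1 / ((k : ℂ) + 3)) = 2 * (k + 4) / (k + 3) := by field_simp; ring
    rw [this]
    exact div_ne_zero (mul_ne_zero two_ne_zero h4) h3
  · have : 1 + 2 * (1 / ((k : ℂ) + 3)) = (k + 5) / (k + 3) := by field_simp; ring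
    rw [this]
    exact div_ne_zero h5 h3
  · have e1 : ((k + 2 : ℕ) : ℂ) + 1 = k + 3 := by push_cast; ring
    rw [e1] at hc
    -- Here the leading factor is 2(n - 1), nonzero because n ≥ 2.
    have : c * (1 / ((k : ℂ) + 3) * ((k + 2) * (2 * k + 5)) - 1 - 1 / (k + 3))
        - (2 * (1 / ((k : ℂ) + 3)) - 1) / 8
        = 2 * (k + 1) * (c - -(1 / (16 * (k + 3)))) := by
      field_simp
      ring
    rw [hdim, this]
    exact mul_ne_zero (mul_ne_zero two_ne_zero h1) (sub_ne_zero.2 hc)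

theorem isTrivialQuotient_sl {n : ℕ} {c : ℂ} (hn : 3 ≤ n)
    (hc : c ≠ -(1 / (8 * ((n : ℂ) + 1)))) :
    IsTrivialQuotient (SpecialLinear.sl (Fin n) ℂ) c := by
  obtain ⟨k, rfl⟩ := Nat.exists_eq_add_of_le' hn
  have hk : ∀ m : ℕ, ((k + (m + 1) : ℕ) : ℂ) ≠ 0 := fun m =>
    Nat.cast_ne_zero.2 (Nat.succ_ne_zero _)
  have h1 : (k : ℂ) + 1 ≠ 0 := by simpa using hk 0
  have h2 : (k : ℂ) + 2 ≠ 0 := by simpa using hk 1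
  have h3 : (k : ℂ) + 3 ≠ 0 := by simpa using hk 2
  have h4 : (k : ℂ) + 4 ≠ 0 := by simpa using hk 3
  have h5 : (k : ℂ) + 5 ≠ 0 := by simpa using hk 4
  have hdim : (finrank ℂ (SpecialLinear.sl (Fin (k + 3)) ℂ) : ℂ) = (k + 2) * (k + 4) := by
    rw [finrank_sl, Fintype.card_fin]; push_cast; ring
  have : Nontrivial (SpecialLinear.sl (Fin (k + 3)) ℂ) :=
    nontrivial_of_finrank_cast_ne_zero (by rw [hdim]; exact mul_ne_zero h2 h4)
  have : IsKilling ℂ (SpecialLinear.sl (Fin (k + 3)) ℂ) := isKilling_sl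
  refine isTrivialQuotient_of_forall_isExtremal (s := 1 / ((k : ℂ) + 3)) (fun e r he => ?_) ?_ ?_ ?_
  · rw [eq_of_isExtremal_sl he, Fintype.card_fin]
    push_cast
    rw [one_div]
  · have : 2 + 2 * (1 / ((k : ℂ) + 3)) = 2 * (k + 4) / (k + 3) := by field_simp; ring
    rw [this]
    exact div_ne_zero (mul_ne_zero two_ne_zero h4) h3
  · have : 1 + 2 * (1 / ((k : ℂ) + 3)) = (k + 5) / (k + 3) := by field_simp; ring
    rw [this]
    exact div_ne_zero h5 h3
  · have e1 : ((k + 3 : ℕ) : ℂ) + 1 = k + 4 := by push_cast; ring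
    rw [e1] at hc
    -- Here the leading factor is (n - 2)(n + 1)/n, nonzero because n ≥ 3.
    have : c * (1 / ((k : ℂ) + 3) * ((k + 2) * (k + 4)) - 1 - 1 / (k + 3))
        - (2 * (1 / ((k : ℂ) + 3)) - 1) / 8
        = (k + 1) * (k + 4) / (k + 3) * (c - -(1 / (8 * (k + 4)))) := by
      field_simp
      ring
    rw [hdim, this]
    exact mul_ne_zero (div_ne_zero (mul_ne_zero h1 h4) h3) (sub_ne_zero.2 hc)

end JosephIdeal

theorem mainTheorem4 :
    (∀ (n : ℕ) (c : ℂ), 5 ≤ n → c ≠ -(((n : ℂ) - 4) / (4 * ((n : ℂ) - 1) * ((n : ℂ) - 2))) →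
      (c ≠ 0 → JosephIdeal.envelopingIdeal (LieAlgebra.Orthogonal.so (Fin n) ℂ) c = ⊤) ∧
      (c = 0 → JosephIdeal.envelopingIdeal (LieAlgebra.Orthogonal.so (Fin n) ℂ) c =
          JosephIdeal.augmentationIdeal (LieAlgebra.Orthogonal.so (Fin n) ℂ) ∧
        IsCoatom (JosephIdeal.augmentationIdeal (LieAlgebra.Orthogonal.so (Fin n) ℂ))) ∧
      Module.Finite ℂ (JosephIdeal.quotientAlgebra (LieAlgebra.Orthogonal.so (Fin n) ℂ) c) ∧
      Module.finrank ℂ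
        (JosephIdeal.quotientAlgebra (LieAlgebra.Orthogonal.so (Fin n) ℂ) c) ≤ 1) ∧
    (∀ (n : ℕ) (c : ℂ), 2 ≤ n → c ≠ -(1 / (16 * ((n : ℂ) + 1))) →
      (c ≠ 0 → JosephIdeal.envelopingIdeal (LieAlgebra.Symplectic.sp (Fin n) ℂ) c = ⊤) ∧
      (c = 0 → JosephIdeal.envelopingIdeal (LieAlgebra.Symplectic.sp (Fin n) ℂ) c =
          JosephIdeal.augmentationIdeal (LieAlgebra.Symplectic.sp (Fin n) ℂ) ∧
        IsCoatom (JosephIdeal.augmentationIdeal (LieAlgebra.Symplectic.sp (Fin n) ℂ))) ∧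
      Module.Finite ℂ (JosephIdeal.quotientAlgebra (LieAlgebra.Symplectic.sp (Fin n) ℂ) c) ∧
      Module.finrank ℂ
        (JosephIdeal.quotientAlgebra (LieAlgebra.Symplectic.sp (Fin n) ℂ) c) ≤ 1) ∧
    (∀ (n : ℕ) (c : ℂ), 3 ≤ n → c ≠ -(1 / (8 * ((n : ℂ) + 1))) →
      (c ≠ 0 → JosephIdeal.envelopingIdeal (LieAlgebra.SpecialLinear.sl (Fin n) ℂ) c = ⊤) ∧
      (c = 0 → JosephIdeal.envelopingIdeal (LieAlgebra.SpecialLinear.sl (Fin n) ℂ) c =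
          JosephIdeal.augmentationIdeal (LieAlgebra.SpecialLinear.sl (Fin n) ℂ) ∧
        IsCoatom (JosephIdeal.augmentationIdeal (LieAlgebra.SpecialLinear.sl (Fin n) ℂ))) ∧
      Module.Finite ℂ (JosephIdeal.quotientAlgebra (LieAlgebra.SpecialLinear.sl (Fin n) ℂ) c) ∧
      Module.finrank ℂ
        (JosephIdeal.quotientAlgebra (LieAlgebra.SpecialLinear.sl (Fin n) ℂ) c) ≤ 1) := by
  exact ⟨fun _ _ hn hc => JosephIdeal.isTrivialQuotient_so hn hc,
    fun _ _ hn hc => JosephIdeal.isTrivialQuotient_sp hn hc,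
    fun _ _ hn hc => JosephIdeal.isTrivialQuotient_sl hn hc⟩
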